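/- An $r$-graph $\mathcal H$ is a family of $r$-element subsets (edges) of a finite vertex set $V(\mathcal H)$; $e(\mathcal H)$ is the number of its edges. A Berge cycle of length $\ell$ in $\mathcal H$ consists of $\ell$ distinct vertices $v_1,\dots,v_\ell$ and $\ell$ distinct edges $e_1,\dots,e_\ell$ of $\mathcal H$ such that $\{v_i,v_{i+1}\}\subseteq e_i$ for all $i$, with indices modulo $\ell$. The $2$-shadow $\partial_2\mathcal H$ is the graph on the vertex set $V(\mathcal H)$ whose edges are the pairs of vertices contained in some edge of $\mathcal H$. A block of a graph is a maximal subgraph that is either $2$-connected or a single edge (so a one-vertex graph has no blocks). For $D\subseteq V(\mathcal H)$, $\mathcal H[D]$ is the family of edges of $\mathcal H$ contained in $D$; for a block $D$, $\mathcal H[D]$ refers to the vertex set of $D$. $K_{m}$ is the complete graph on $m$ vertices and $K_m^{(r)}$ the family of all $r$-element subsets of an $m$-element set. **Theorem.** Let $r\ge 3$, $k\ge r+3$ and $n\ge 1$ be integers, and let $\mathcal H$ be an $r$-graph on $n$ vertices that contains no Berge cycle of length $k$ or longer. Then $$e(\mathcal H)\le \frac{n-1}{k-2}\binom{k-1}{r}.$$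 Moreover, equality holds if and only if $\partial_2\mathcal H$ is connected and for every block $D$ of $\partial_2\mathcal H$, $D=K_{k-1}$ and $\mathcal H[D]=K_{k-1}^{(r)}$. -/

import Mathlib

namespace BergeCycles

/-- A family `H` of finite subsets of `V` is regarded as a hypergraph with vertex set `V`.
`H` contains a Berge cycle of length `ℓ`: there are `ℓ` distinct vertices `v 0, …, v (ℓ - 1)` and
`ℓ` distinct edges `e 0, …, e (ℓ - 1)` of `H` such that `e i` contains `v i` and `v (i + 1)`, with
indices modulo `ℓ` (`finRotate ℓ` is the map `i ↦ i + 1` modulo `ℓ`). -/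
def HasBergeCycle {V : Type*} (H : Finset (Finset V)) (ℓ : ℕ) : Prop :=
  2 ≤ ℓ ∧ ∃ (v : Fin ℓ → V) (e : Fin ℓ → Finset V),
    Function.Injective v ∧ Function.Injective e ∧
      ∀ i : Fin ℓ, e i ∈ H ∧ v i ∈ e i ∧ v (finRotate ℓ i) ∈ e i

/-- The `2`-shadow of `H`, as a graph on the whole vertex set `V`: two distinct vertices are
adjacent iff some edge of `H` contains both. -/
def twoShadow {V : Type*} (H : Finset (Finset V)) : SimpleGraph V where
  Adj x y := x ≠ y ∧ ∃ e ∈ H, x ∈ e ∧ y ∈ e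
  symm := ⟨fun _ _ h => ⟨h.1.symm, h.2.imp fun _ he => ⟨he.1, he.2.2, he.2.1⟩⟩⟩
  loopless := ⟨fun _ h => h.1 rfl⟩

/-- The subgraph of `G` induced by `D` has at least two vertices, is connected, and has no cut
vertex (equivalently, it is `2`-connected or a single edge). -/
def IsNonseparable {V : Type*} (G : SimpleGraph V) (D : Finset V) : Prop :=
  2 ≤ D.card ∧ (G.induce (D : Set V)).Connected ∧
    ∀ v ∈ D, (G.induce ((D : Set V) \ {v})).Connected

/-- `D` is the vertex set of a block of `G`. A block, a maximal subgraph that is `2`-connected or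
a single edge, is always an induced subgraph, so it is given by its vertex set. -/
def IsBlock {V : Type*} (G : SimpleGraph V) (D : Finset V) : Prop :=
  Maximal (IsNonseparable G) D

/-- The edges of the hypergraph `H[D]` induced by `D`: the edges of `H` contained in `D`. -/
def inducedEdges {V : Type*} [DecidableEq V] (H : Finset (Finset V)) (D : Finset V) :
    Finset (Finset V) :=
  H.filter (fun e => e ⊆ D)

end BergeCycles

/-!
Write `c = k - 1`. The proof reduces the theorem to the Erdős–Gallai theorem for cycles: a graph
on `n` vertices without cycles of more than `c` vertices has at most `c (n - 1) / 2` edges, with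
equality only for connected graphs all of whose blocks are complete of order `c`
(`CircumferenceLE.sum_degIn_le`). This theorem is proved by deleting a set `T` of vertices which
is incident with at most `c |T| / 2` edges. Such a set consists of the first vertices of the
rotations of a suitable longest path (`CircumferenceLE.exists_deletable`).

To pass from `H` to a graph, apply Hall's theorem to a subfamily `H₁` of `H` for which the excess of
`|H₁|` over the number of pairs covered by `H₁` is largest (`exists_representation`). It gives a
set `P₁` of pairs, containing all pairs inside edges of `H₁`, and a disjoint set `P₂` with
`|P₂| = |H \ H₁|`, such that the pairs in `P = P₁ ∪ P₂` have distinct representatives in `H`. A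
cycle in the graph `P` is then a Berge cycle of the same length, so the Erdős–Gallai theorem bounds
`|P|`. Edges of `H₁` are `r`-cliques in the graph `P₁`. Counting cliques through neighbourhoods,
which contain no path on `c` vertices, shows that there are at most
`|P₁| (c choose r) / (c choose 2)` of them (`CircumferenceLE.card_cliquesIn_le`). As
`(c choose 2) ≤ (c choose r)`, which is where `k ≥ r + 3` enters, it follows that
`|H| ≤ |P| (c choose r) / (c choose 2)`, and this is the bound.

If equality holds, the graph `P` is extremal, hence a tree of cliques of order `c`. All pairs inside
an edge of `H` belong to `P`: otherwise a missing pair could replace the pair represented by that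
edge, and both graphs could not be trees of cliques (`IsRepresentation.pair_mem`). So every edge of
`H` lies in one of the cliques, and by counting every `r`-subset of a clique is an edge of `H`
(`extremal_structure`). The cliques are the blocks, since a larger nonseparable set would give an
ear of a clique and thus a cycle of more than `c` vertices
(`CircumferenceLE.subset_of_isNonseparable`).

Conversely, if the shadow is connected and all blocks are complete of order `c`, then there are at
least `(n - 1) / (c - 1)` blocks, as spanning stars of the blocks form a connected graph together
(`card_le_of_connected`). They pairwise share at most one vertex, so `H` has at least the extremal
number of edges (`le_mul_card_of_blocks`).
-/

namespace BergeCycles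

open Finset

section

variable {V : Type*} {G : SimpleGraph V} {S : Finset V} {c : ℕ}

/-! ### Paths, cycles and trees of cliques -/

/-- `l` lists the vertices, in order, of a path of `G` inside `S`. -/
def IsPathIn (G : SimpleGraph V) (S : Finset V) (l : List V) : Prop :=
  l.Nodup ∧ l.IsChain G.Adj ∧ ∀ x ∈ l, x ∈ S

/-- Every cycle of `G` inside `S` has at most `c` vertices. A cycle is given by the list of its
vertices, up to rotation. -/
def CircumferenceLE (G : SimpleGraph V) (S : Finset V) (c : ℕ) : Prop :=
  ∀ l : List V, l.Nodup → (∀ x ∈ l, x ∈ S) → 3 ≤ l.length → (l : Cycle V).Chain G.Adj →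
    l.length ≤ c

open Classical in
/-- The number of neighbours of `x` in `S`. -/
noncomputable def degIn (G : SimpleGraph V) (S : Finset V) (x : V) : ℕ :=
  #{y ∈ S | G.Adj x y}

/-- `S` is connected in `G`, and every edge of `G` inside `S` lies in a clique of order `c`
inside `S`. Under `CircumferenceLE G S c` this says that `G[S]` is connected with all blocks
complete of order `c`. -/
def CliqueTree (G : SimpleGraph V) (S : Finset V) (c : ℕ) : Prop :=
  (∀ a ∈ S, ∀ b ∈ S, ∃ l, IsPathIn G S l ∧ l.head? = some a ∧ l.getLast? = some b) ∧
    ∀ x ∈ S, ∀ y ∈ S, G.Adj x y → ∃ D ⊆ S, G.IsNClique c D ∧ x ∈ D ∧ y ∈ D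

theorem CircumferenceLE.mono {T : Finset V} (h : CircumferenceLE G S c) (hT : T ⊆ S) :
    CircumferenceLE G T c :=
  fun l h1 h2 => h l h1 fun x hx => hT (h2 x hx)

theorem IsPathIn.mono {T : Finset V} {l : List V} (h : IsPathIn G T l) (hT : T ⊆ S) :
    IsPathIn G S l :=
  ⟨h.1, h.2.1, fun x hx => hT (h.2.2 x hx)⟩

theorem IsPathIn.reverse {l : List V} (h : IsPathIn G S l) : IsPathIn G S l.reverse :=
  ⟨List.nodup_reverse.2 h.1, List.isChain_reverse.2 (h.2.1.imp fun _ _ h => h.symm),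
    fun x hx => h.2.2 x (List.mem_reverse.1 hx)⟩

theorem IsPathIn.length_le {l : List V} (h : IsPathIn G S l) : l.length ≤ #S := by
  classical
  rw [← List.toFinset_card_of_nodup h.1]
  exact card_le_card fun x hx => h.2.2 x (List.mem_toFinset.1 hx)

theorem IsPathIn.cons {l : List V} {x : V} (h : IsPathIn G S l) (hx : x ∈ S) (hxl : x ∉ l)
    (hadj : ∀ y ∈ l.head?, G.Adj x y) : IsPathIn G S (x :: l) :=
  ⟨List.nodup_cons.2 ⟨hxl, h.1⟩, List.isChain_cons.2 ⟨hadj, h.2.1⟩, by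
    simpa [hx] using h.2.2⟩

/-- A path whose ends are adjacent is a cycle. -/
theorem CircumferenceLE.length_le {a b : V} {l : List V} (h : CircumferenceLE G S c)
    (hl : IsPathIn G S (a :: (l ++ [b]))) (hl0 : l ≠ []) (hab : G.Adj b a) : l.length + 2 ≤ c := by
  have := h _ hl.1 hl.2.2 (by have := List.length_pos_iff.2 hl0; simp; omega) (by
    rw [Cycle.chain_coe_cons]
    have h2 := hl.2.1
    rw [← List.cons_append, List.isChain_append]
    refine ⟨h2, by simp, ?_⟩
    have : (a :: (l ++ [b])).getLast? = some b := by
      rw [← List.cons_append, List.getLast?_append]; simp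
    rw [this]; simpa using hab)
  simp at this
  omega

/-- A Hamiltonian path, without its ends, of a clique. -/
theorem exists_hamiltonian_path {D : Finset V} (hD : G.IsNClique c D) {a b : V} (ha : a ∈ D)
    (hb : b ∈ D) (hab : a ≠ b) :
    ∃ m : List V, IsPathIn G D (a :: (m ++ [b])) ∧ m.length + 2 = c := by
  classical
  refine ⟨((D.erase a).erase b).toList, ⟨?_, ?_, ?_⟩, ?_⟩
  · simp +contextual [List.nodup_append, Finset.nodup_toList, hab]
  · apply List.Pairwise.isChain
    apply List.Nodup.pairwise_of_forall_ne
    · simp +contextual [List.nodup_append, Finset.nodup_toList, hab]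
    · intro x hx y hy hxy
      apply hD.1 _ _ hxy
      · simp at hx; rcases hx with rfl | ⟨_, _, h⟩ | rfl <;> simp [*]
      · simp at hy; rcases hy with rfl | ⟨_, _, h⟩ | rfl <;> simp [*]
  · intro x hx
    simp at hx; rcases hx with rfl | ⟨_, _, h⟩ | rfl <;> simp [*]
  · have h1 : b ∈ D.erase a := by simp [hb, hab.symm]
    rw [Finset.length_toList, card_erase_of_mem h1, card_erase_of_mem ha, hD.2]
    have := one_lt_card.2 ⟨a, ha, b, hb, hab⟩
    have := hD.2
    omega

/-- No ear can be attached to a clique of order `c`: a Hamiltonian path of the clique would close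
it to a cycle with more than `c` vertices. -/
theorem CircumferenceLE.no_ear (h : CircumferenceLE G S c) {D : Finset V} (hD : G.IsNClique c D)
    (hDS : D ⊆ S) {a b : V} (ha : a ∈ D) (hb : b ∈ D) (hab : a ≠ b) {l : List V} (hl0 : l ≠ [])
    (hl : IsPathIn G S l) (hdisj : ∀ x ∈ l, x ∉ D) (hla : ∀ x ∈ l.head?, G.Adj a x)
    (hlb : ∀ x ∈ l.getLast?, G.Adj x b) : False := by
  obtain ⟨m, hm, hmc⟩ := exists_hamiltonian_path hD hb ha hab.symm
  obtain ⟨z, l', rfl⟩ := List.exists_cons_of_ne_nil hl0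
  have key : IsPathIn G S (z :: ((l' ++ b :: m) ++ [a])) := by
    have e : z :: ((l' ++ b :: m) ++ [a]) = (z :: l') ++ (b :: (m ++ [a])) := by simp
    rw [e]
    refine ⟨?_, ?_, ?_⟩
    · rw [List.nodup_append]
      refine ⟨hl.1, hm.1, ?_⟩
      rintro x hx y hy rfl
      exact hdisj x hx (hm.2.2 x hy)
    · rw [List.isChain_append]
      exact ⟨hl.2.1, hm.2.1, by simpa using hlb⟩
    · intro x hx
      rcases List.mem_append.1 hx with hx | hx
      · exact hl.2.2 x hx
      · exact hDS (hm.2.2 x hx)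
  have := h.length_le key (by simp) (hla z (by simp))
  simp at this
  omega

theorem CircumferenceLE.mem_of_adj_of_adj (h : CircumferenceLE G S c) {D : Finset V}
    (hD : G.IsNClique c D) (hDS : D ⊆ S) {a b z : V} (ha : a ∈ D) (hb : b ∈ D) (hab : a ≠ b)
    (hz : z ∈ S) (hza : G.Adj a z) (hzb : G.Adj b z) : z ∈ D := by
  by_contra hzD
  exact h.no_ear hD hDS ha hb hab (l := [z]) (by simp) ⟨by simp, by simp, by simpa using hz⟩
    (by simpa using hzD) (by simpa using hza) (by simpa using hzb.symm)

theorem exists_eq_append_of_last (p : V → Prop) : ∀ l : List V, (∃ x ∈ l, p x) →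
    ∃ A y B, l = A ++ y :: B ∧ p y ∧ ∀ z ∈ B, ¬ p z
  | [], h => by simp at h
  | x :: l, h => by
    by_cases hl : ∃ x ∈ l, p x
    · obtain ⟨A, y, B, rfl, h1, h2⟩ := exists_eq_append_of_last p l hl
      exact ⟨x :: A, y, B, rfl, h1, h2⟩
    · refine ⟨[], x, l, rfl, ?_, fun z hz hp => hl ⟨z, hz, hp⟩⟩
      obtain ⟨y, hy, hp⟩ := h
      rcases List.mem_cons.1 hy with rfl | hy
      · exact hp
      · exact (hl ⟨y, hy, hp⟩).elim

/-- Two vertices of a tree of cliques of order `c` are joined by a path with at least `c`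
vertices: make a detour through all of the first clique. -/
theorem CliqueTree.exists_long_path (h : CliqueTree G S c) {a b : V} (ha : a ∈ S) (hb : b ∈ S)
    (hab : a ≠ b) : ∃ m, IsPathIn G S (a :: (m ++ [b])) ∧ c ≤ m.length + 2 := by
  obtain ⟨l, hl, hla, hlb⟩ := h.1 a ha b hb
  obtain _ | ⟨a', _ | ⟨x, l'⟩⟩ := l
  · simp at hla
  · simp at hla hlb; exact (hab (hla.symm.trans hlb)).elim
  simp only [List.head?_cons, Option.some.injEq] at hla
  subst hla
  have hax : G.Adj a' x := by have := hl.2.1; simp at this; exact this.1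
  obtain ⟨D, hDS, hD, haD, hxD⟩ := h.2 a' ha x (hl.2.2 x (by simp)) hax
  obtain ⟨A, y, B, hl', hyD, hB⟩ := exists_eq_append_of_last (· ∈ D) (x :: l') ⟨x, by simp, hxD⟩
  rw [hl'] at hl hlb
  have hay : a' ≠ y := by
    have := hl.1; simp at this; rintro rfl; simp at this
  obtain ⟨m, hm, hmc⟩ := exists_hamiltonian_path hD haD hyD hay
  have key : IsPathIn G S ((a' :: m) ++ y :: B) := by
    have hyB : IsPathIn G S (y :: B) := ⟨by
        have := hl.1; rw [← List.cons_append, List.nodup_append] at this; exact this.2.1, by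
        have := hl.2.1; rw [← List.cons_append, List.isChain_append] at this; exact this.2.1,
        fun z hz => hl.2.2 z (by simp only [List.mem_cons, List.mem_append] at hz ⊢; tauto)⟩
    have h1 := hm.1
    have h2 := hm.2.1
    rw [← List.cons_append] at h1 h2
    rw [List.nodup_append] at h1
    rw [List.isChain_append] at h2
    refine ⟨?_, ?_, ?_⟩
    · rw [List.nodup_append]
      refine ⟨h1.1, hyB.1, ?_⟩
      rintro z hz z' hz' rfl
      rcases List.mem_cons.1 hz' with rfl | hz'
      · exact h1.2.2 _ hz _ (by simp) rfl
      · exact hB z hz' (hm.2.2 z (by rw [← List.cons_append]; exact List.mem_append_left _ hz))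
    · rw [List.isChain_append]
      exact ⟨h2.1, hyB.2.1, by simpa using h2.2.2⟩
    · intro z hz
      rcases List.mem_append.1 hz with hz | hz
      · exact hDS (hm.2.2 z (by rw [← List.cons_append]; exact List.mem_append_left _ hz))
      · exact hyB.2.2 z hz
  have hlast : (y :: B).getLast? = some b := by
    rw [← List.cons_append, List.getLast?_append] at hlb
    simpa using hlb
  obtain ⟨B', hB'⟩ := List.getLast?_eq_some_iff.1 hlast
  refine ⟨m ++ B', ?_, by simp; omega⟩
  rw [hB'] at key
  simpa using key

end

section

variable {V : Type*} {G : SimpleGraph V} {S : Finset V} {c : ℕ}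

/-! ### Rotations of longest paths -/

theorem exists_forall_le_of_bounded {α : Type*} {p : α → Prop} (f : α → ℕ) (N : ℕ)
    (h : ∃ x, p x) (hN : ∀ x, p x → f x ≤ N) : ∃ x, p x ∧ ∀ y, p y → f y ≤ f x := by
  have hb : BddAbove (f '' {x | p x}) := ⟨N, by rintro _ ⟨x, hx, rfl⟩; exact hN x hx⟩
  obtain ⟨x, hx, hfx⟩ := Nat.sSup_mem (s := f '' {x | p x}) (h.imp' f fun x hx => ⟨x, hx, rfl⟩) hb
  exact ⟨x, hx, fun y hy => hfx ▸ le_csSup hb ⟨y, hy, rfl⟩⟩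

/-- Rotation of a path that starts at `t`, along a further edge at `t`. -/
theorem IsPathIn.rotate {A R : List V} {t y : V} (h : IsPathIn G S (A ++ y :: R))
    (ht : A.head? = some t) (hty : G.Adj t y) : IsPathIn G S (A.reverse ++ y :: R) := by
  have hp : (A.reverse ++ y :: R).Perm (A ++ y :: R) := (List.reverse_perm A).append_right _
  have h2 := List.isChain_append.1 h.2.1
  refine ⟨hp.nodup_iff.2 h.1, ?_, fun x hx => h.2.2 x (hp.mem_iff.1 hx)⟩
  rw [List.isChain_append]
  refine ⟨List.isChain_reverse.2 (h2.1.imp fun _ _ h => h.symm), h2.2.1, ?_⟩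
  rw [List.getLast?_reverse, ht]
  simpa using hty

/-- A graph with an edge has a set `T` of vertices that is cheap to delete: the neighbours of `T`
are confined to a set `W` of at most `c` vertices, and all degrees on `T` are at most `#T`.

Take a longest path `t, m, w, u` for which `t` is adjacent to `w` and the segment `m` is as long
as possible. `T` is the set of first vertices of the paths `q, w, u`, where `q` is a rearrangement
of `t, m`, and `W` consists of `t`, `m` and `w`. Rotating the path that starts at a vertex of `T`
of maximum degree produces as many elements of `T` as that vertex has neighbours. -/
theorem CircumferenceLE.exists_deletable (h : CircumferenceLE G S c) (hc : 2 ≤ c)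
    (hE : ∃ x ∈ S, ∃ y ∈ S, G.Adj x y) :
    ∃ T W : Finset V, T.Nonempty ∧ T ⊂ W ∧ W ⊆ S ∧ #W ≤ c ∧ (∀ t ∈ T, degIn G S t ≤ #T) ∧
      ∀ t ∈ T, ∀ y ∈ S, G.Adj t y → y ∈ W := by
  classical
  obtain ⟨l₀, hl₀, hmax⟩ := exists_forall_le_of_bounded (p := IsPathIn G S) List.length #S
    ⟨[], by simp [IsPathIn]⟩ fun l hl => hl.length_le
  obtain ⟨⟨t, m, w, u⟩, ⟨hP, hlen, htw⟩, hm⟩ := exists_forall_le_of_bounded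
    (p := fun x : V × List V × V × List V => IsPathIn G S (x.1 :: x.2.1 ++ x.2.2.1 :: x.2.2.2) ∧
      (x.1 :: x.2.1 ++ x.2.2.1 :: x.2.2.2).length = l₀.length ∧ G.Adj x.1 x.2.2.1)
    (fun x => x.2.1.length) l₀.length
    (by
      obtain ⟨x, hx, y, hy, hxy⟩ := hE
      have h2 := hmax [x, y] ⟨by simpa using hxy.ne, by simpa using hxy, by simp [hx, hy]⟩
      obtain _ | ⟨a, _ | ⟨b, u⟩⟩ := l₀
      · simp at h2
      · simp at h2
      · refine ⟨⟨a, [], b, u⟩, hl₀, rfl, ?_⟩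
        have := hl₀.2.1
        simp at this
        exact this.1)
    (by rintro ⟨a, m, b, u⟩ ⟨-, h2, -⟩; simp at h2 ⊢; omega)
  dsimp only at hP hlen htw hm
  let T : Finset V := {x ∈ (t :: m).toFinset | ∃ q : List V, q.Perm (t :: m) ∧ q.head? = some x ∧
    IsPathIn G S (q ++ w :: u)}
  let W : Finset V := (t :: m ++ [w]).toFinset
  have hwtm : w ∉ t :: m := fun hw => by
    have := (List.nodup_append.1 hP.1).2.2 w hw w (by simp)
    exact this rfl
  have hN : ∀ q : List V, q.Perm (t :: m) → IsPathIn G S (q ++ w :: u) → ∀ x, q.head? = some x →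
      ∀ y ∈ S, G.Adj x y → y ∈ q ++ [w] := by
    intro q hq hqP x hx y hy hxy
    by_contra hyq
    have hlq : (q ++ w :: u).length = l₀.length := by
      rw [← hlen, List.length_append, List.length_append, hq.length_eq]
    obtain ⟨q', rfl⟩ : ∃ q', q = x :: q' := by
      obtain _ | ⟨a, q'⟩ := q
      · simp at hx
      · simp at hx; exact ⟨q', by rw [hx]⟩
    by_cases hyu : y ∈ u
    · obtain ⟨u₁, u₂, rfl⟩ := List.append_of_mem hyu
      have := hm ⟨x, q' ++ w :: u₁, y, u₂⟩ ⟨by simpa using hqP, by simpa using hlq, hxy⟩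
      have hql := hq.length_eq
      simp at this hql
      omega
    · have := hmax (y :: (x :: q' ++ w :: u)) (hqP.cons hy (by simp at hyq ⊢; tauto)
        (by simpa using hxy.symm))
      rw [List.length_cons, hlq] at this
      omega
  have hTdeg : ∀ x ∈ T, degIn G S x ≤ #T := by
    intro x hx
    obtain ⟨-, q, hq, hqx, hqP⟩ := mem_filter.1 hx
    -- the successor of a vertex along `q, w`
    let f : V → V := fun z => (q ++ [w]).getD ((q ++ [w]).idxOf z + 1) z
    have hnd : (q ++ [w]).Nodup := by
      have := hqP.1
      rw [← List.singleton_append, ← List.append_assoc, List.nodup_append] at this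
      exact this.1
    have hTmem : ∀ q' : List V, q'.Perm q → IsPathIn G S (q' ++ w :: u) →
        ∀ z, q'.head? = some z → z ∈ T := by
      intro q' hq' hP' z hz
      refine mem_filter.2 ⟨?_, q', hq'.trans hq, hz, hP'⟩
      rw [List.mem_toFinset]
      exact (hq'.trans hq).mem_iff.1 (List.mem_of_mem_head? hz)
    have hf : ∀ A z y B, q ++ [w] = A ++ z :: y :: B → f z = y := by
      intro A z y B hAB
      rw [hAB] at hnd
      have hzA : z ∉ A := fun hz => (List.nodup_append.1 hnd).2.2 z hz z (by simp) rfl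
      simp [f, hAB, List.idxOf_append, hzA]
    refine (card_le_card (t := T.image f) ?_).trans card_image_le
    intro y hy
    obtain ⟨hyS, hxy⟩ := mem_filter.1 hy
    rw [mem_image]
    have hyq := hN q hq hqP x hqx y hyS hxy
    -- the part `A` before the neighbour `y` gets reversed, so its last vertex becomes the first
    have hsplit : ∃ A B, q ++ w :: u = A ++ y :: B ∧ ∃ B', q ++ [w] = A ++ y :: B' ∧
        A.head? = some x ∧ ∀ z, IsPathIn G S (A.reverse ++ y :: B) →
          A.reverse.head? = some z → z ∈ T := by
      rcases List.mem_append.1 hyq with hyq | hyw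
      · obtain ⟨A, B, rfl⟩ := List.append_of_mem hyq
        have hA : A.head? = some x := by
          obtain _ | ⟨a, A⟩ := A
          · simp at hqx; exact (hxy.ne hqx.symm).elim
          · simpa using hqx
        refine ⟨A, B ++ w :: u, by simp, B ++ [w], by simp, hA, fun z hz hzA => ?_⟩
        refine hTmem (A.reverse ++ y :: B) ((List.reverse_perm A).append_right _)
          (by simpa using hz) z ?_
        rw [List.head?_append, hzA]; rfl
      · obtain rfl : y = w := by simpa using hyw
        exact ⟨q, u, rfl, [], rfl, hqx, fun z hz hzA => hTmem _ (List.reverse_perm q) hz z hzA⟩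
    obtain ⟨A, B, hAB, B', hAB', hA, hAT⟩ := hsplit
    rw [hAB] at hqP
    have hrot := hqP.rotate hA hxy
    obtain rfl | ⟨A', z, rfl⟩ := List.eq_nil_or_concat A
    · simp at hA
    · exact ⟨z, hAT z hrot (by simp), hf A' z y B' (by simpa using hAB')⟩
  refine ⟨T, W, ⟨t, mem_filter.2 ⟨by simp, t :: m, .refl _, rfl, hP⟩⟩, ?_, ?_, ?_, hTdeg, ?_⟩
  · refine ⟨fun x hx => ?_, fun hWT => hwtm ?_⟩
    · have := (mem_filter.1 hx).1
      simp [W] at this ⊢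
      tauto
    · exact List.mem_toFinset.1 (mem_filter.1 (hWT (by simp [W] : w ∈ W))).1
  · intro x hx
    refine hP.2.2 x ?_
    simp [W] at hx ⊢
    tauto
  · refine (List.toFinset_card_le _).trans ?_
    by_cases hm0 : m = []
    · simpa [hm0] using hc
    · have hP' : IsPathIn G S (t :: (m ++ [w])) := by
        have e : t :: m ++ w :: u = (t :: (m ++ [w])) ++ u := by simp
        rw [e] at hP
        exact ⟨(List.nodup_append.1 hP.1).1, (List.isChain_append.1 hP.2.1).1,
          fun x hx => hP.2.2 x (List.mem_append_left _ hx)⟩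
      have := h.length_le hP' hm0 htw.symm
      simp
      omega
  · intro x hx y hy hxy
    obtain ⟨-, q, hq, hqx, hqP⟩ := mem_filter.1 hx
    have := hN q hq hqP x hqx y hy hxy
    rw [List.mem_append, hq.mem_iff, ← List.mem_append] at this
    exact List.mem_toFinset.2 this

end

section

variable {V : Type*} {G : SimpleGraph V} {S : Finset V} {c : ℕ}

/-! ### The Erdős–Gallai theorem for cycles -/

theorem degIn_mono {T : Finset V} (h : T ⊆ S) (x : V) : degIn G T x ≤ degIn G S x := by
  classical exact card_le_card (filter_subset_filter _ h)

theorem degIn_add_degIn_sdiff [DecidableEq V] {T : Finset V} (h : T ⊆ S) (x : V) :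
    degIn G (S \ T) x + degIn G T x = degIn G S x := by
  classical
  unfold degIn
  rw [← card_union_of_disjoint (disjoint_filter_filter (sdiff_disjoint)), ← filter_union,
    sdiff_union_of_subset h]

theorem sum_degIn_comm (S T : Finset V) : ∑ x ∈ S, degIn G T x = ∑ x ∈ T, degIn G S x := by
  classical
  have := sum_card_bipartiteAbove_eq_sum_card_bipartiteBelow G.Adj (s := S) (t := T)
  refine (sum_congr rfl fun x _ => ?_).trans (this.trans (sum_congr rfl fun x _ => ?_))
  · unfold degIn bipartiteAbove; congr
  · unfold degIn bipartiteBelow; congr 1; ext; simp [G.adj_comm]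

theorem sum_degIn_eq_sdiff [DecidableEq V] {T : Finset V} (h : T ⊆ S) :
    ∑ x ∈ S, degIn G S x = ∑ x ∈ S \ T, degIn G (S \ T) x +
      ∑ x ∈ T, (degIn G S x + degIn G (S \ T) x) := by
  rw [← sum_sdiff h, sum_add_distrib,
    ← sum_congr rfl fun x (_ : x ∈ S \ T) => degIn_add_degIn_sdiff h x, sum_add_distrib,
    sum_degIn_comm (S \ T) T]
  ring

/-- **Erdős–Gallai theorem for cycles**, with its extremal graphs, for the subgraph induced by
`S`. The sum of the degrees is twice the number of edges. -/
theorem CircumferenceLE.sum_degIn_le (h : CircumferenceLE G S c) (hc : 2 ≤ c) (hS : S.Nonempty) :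
    ∑ x ∈ S, degIn G S x + c ≤ c * #S ∧
      (∑ x ∈ S, degIn G S x + c = c * #S → CliqueTree G S c) := by
  classical
  induction S using Finset.strongInduction with
  | H S ih =>
  have hS1 := hS.card_pos
  by_cases hE : ∃ x ∈ S, ∃ y ∈ S, G.Adj x y
  swap
  · push Not at hE
    have h0 : ∑ x ∈ S, degIn G S x = 0 := sum_eq_zero fun x hx =>
      card_eq_zero.2 (filter_eq_empty_iff.2 fun y hy => hE x hx y hy)
    rw [h0]
    refine ⟨by nlinarith, fun h1 => ⟨fun a ha b hb => ?_, fun x hx y hy hxy =>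
      (hE x hx y hy hxy).elim⟩⟩
    have hcard : #S ≤ 1 := by
      by_contra! h2
      nlinarith
    obtain rfl := card_le_one.1 hcard a ha b hb
    exact ⟨[a], ⟨by simp, by simp, by simpa using ha⟩, rfl, rfl⟩
  obtain ⟨T, W, hT0, hTW, hWS, hWc, hTdeg, hTN⟩ := h.exists_deletable hc hE
  have hTS : T ⊆ S := hTW.1.trans hWS
  have hTWc : #T < #W := card_lt_card hTW
  have hTSc : #T < #S := hTWc.trans_le (card_le_card hWS)
  have hsd : #(S \ T) = #S - #T := card_sdiff_of_subset hTS
  have hWT : #(W \ T) = #W - #T := card_sdiff_of_subset hTW.1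
  have hne : (S \ T).Nonempty := card_pos.1 (by omega)
  obtain ⟨ih1, ih2⟩ := ih (S \ T) (sdiff_ssubset hTS hT0) (h.mono sdiff_subset) hne
  have hsub : ∀ t ∈ T, {y ∈ S \ T | G.Adj t y} ⊆ W \ T := by
    intro t ht y hy
    simp only [mem_filter, mem_sdiff] at hy ⊢
    exact ⟨hTN t ht y hy.1.1 hy.2, hy.1.2⟩
  have hout : ∀ t ∈ T, degIn G (S \ T) t ≤ #W - #T := fun t ht => by
    have := card_le_card (hsub t ht)
    rw [hWT] at this
    unfold degIn
    convert this
  have hterm : ∀ t ∈ T, degIn G S t + degIn G (S \ T) t ≤ c := fun t ht => by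
    have := hTdeg t ht
    have := hout t ht
    omega
  have hsum := sum_le_sum hterm
  rw [sum_const, smul_eq_mul] at hsum
  have hcs : c * #S = c * #(S \ T) + #T * c := by
    rw [hsd, mul_comm (#T), ← mul_add]
    congr 1; omega
  rw [sum_degIn_eq_sdiff hTS]
  refine ⟨by omega, fun heq => ?_⟩
  have hct := ih2 (by omega)
  have hterm' : ∀ t ∈ T, degIn G S t + degIn G (S \ T) t = c :=
    (sum_eq_sum_iff_of_le hterm).1 (by rw [sum_const, smul_eq_mul]; omega)
  obtain ⟨t₀, ht₀⟩ := hT0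
  have hWc' : #W = c := by
    have := hTdeg t₀ ht₀; have := hout t₀ ht₀; have := hterm' t₀ ht₀; omega
  have hfull : ∀ t ∈ T, ∀ y ∈ W \ T, G.Adj t y := by
    intro t ht y hy
    have : {y ∈ S \ T | G.Adj t y} = W \ T := by
      refine eq_of_subset_of_card_le (hsub t ht) ?_
      have h1 := hTdeg t ht; have h2 := hterm' t ht
      have : #(W \ T) ≤ degIn G (S \ T) t := by omega
      unfold degIn at this
      convert this
    rw [← this] at hy
    exact (mem_filter.1 hy).2
  -- `T` is joined to the rest by a single vertex, since a long path between two such vertices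
  -- could be closed through `T`
  have hone : #(W \ T) = 1 := by
    by_contra hne1
    obtain ⟨a, ha, b, hb, hab⟩ := one_lt_card.1 (show 1 < #(W \ T) by omega)
    have hWT' : W \ T ⊆ S \ T := sdiff_subset_sdiff hWS le_rfl
    obtain ⟨m, hm, hmc⟩ := hct.exists_long_path (hWT' ha) (hWT' hb) hab
    have hlt : IsPathIn G S (t₀ :: ((a :: m) ++ [b])) := by
      refine (hm.mono sdiff_subset).cons (hTS ht₀) (fun hmem => ?_) ?_
      · exact (mem_sdiff.1 (hm.2.2 _ hmem)).2 ht₀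
      · simpa using hfull t₀ ht₀ a ha
    have := h.length_le hlt (by simp) (hfull t₀ ht₀ b hb).symm
    simp at this
    omega
  obtain ⟨w, hw⟩ := card_eq_one.1 hone
  have hwW : w ∈ W \ T := by rw [hw]; simp
  have hwS : w ∈ S \ T := sdiff_subset_sdiff hWS le_rfl hwW
  have hTadj : ∀ t ∈ T, ∀ y ∈ W, t ≠ y → G.Adj t y := by
    intro t ht y hy hty
    have h1 : {y ∈ S | G.Adj t y} = W.erase t := by
      refine eq_of_subset_of_card_le (fun z hz => ?_) ?_
      · rw [mem_filter] at hz
        exact mem_erase.2 ⟨hz.2.ne', hTN t ht z hz.1 hz.2⟩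
      · rw [card_erase_of_mem (hTW.1 ht)]
        have h2 := hterm' t ht
        have h3 := hout t ht
        have : #W - 1 ≤ degIn G S t := by omega
        unfold degIn at this
        convert this
    have : y ∈ W.erase t := mem_erase.2 ⟨hty.symm, hy⟩
    rw [← h1] at this
    exact (mem_filter.1 this).2
  have hWcl : G.IsNClique c W := by
    refine ⟨fun x hx y hy hxy => ?_, hWc'⟩
    by_cases hxT : x ∈ T
    · exact hTadj x hxT y hy hxy
    by_cases hyT : y ∈ T
    · exact (hTadj y hyT x hx hxy.symm).symm
    have hx' : x ∈ W \ T := mem_sdiff.2 ⟨hx, hxT⟩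
    have hy' : y ∈ W \ T := mem_sdiff.2 ⟨hy, hyT⟩
    rw [hw, mem_singleton] at hx' hy'
    exact (hxy (hx'.trans hy'.symm)).elim
  have hmix : ∀ a ∈ T, ∀ b ∈ S \ T, ∃ l, IsPathIn G S l ∧ l.head? = some a ∧
      l.getLast? = some b := by
    intro a ha b hb
    obtain ⟨l, hl, hlw, hlb⟩ := hct.1 w hwS b hb
    refine ⟨a :: l, (hl.mono sdiff_subset).cons (hTS ha)
      (fun hal => (mem_sdiff.1 (hl.2.2 a hal)).2 ha) ?_, rfl, ?_⟩
    · rw [hlw]; simpa using hfull a ha w hwW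
    · rw [List.getLast?_cons, hlb]; rfl
  refine ⟨fun a ha b hb => ?_, fun x hx y hy hxy => ?_⟩
  · by_cases haT : a ∈ T <;> by_cases hbT : b ∈ T
    · obtain rfl | hab := eq_or_ne a b
      · exact ⟨[a], ⟨by simp, by simp, by simpa using ha⟩, rfl, rfl⟩
      · exact ⟨[a, b], ⟨by simpa using hab, by simpa using hTadj a haT b (hTW.1 hbT) hab,
          by simp [ha, hb]⟩, rfl, rfl⟩
    · exact hmix a haT b (mem_sdiff.2 ⟨hb, hbT⟩)
    · obtain ⟨l, hl, hlb, hla⟩ := hmix b hbT a (mem_sdiff.2 ⟨ha, haT⟩)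
      exact ⟨l.reverse, hl.reverse, by simpa using hla, by simpa using hlb⟩
    · obtain ⟨l, hl, h1, h2⟩ := hct.1 a (mem_sdiff.2 ⟨ha, haT⟩) b (mem_sdiff.2 ⟨hb, hbT⟩)
      exact ⟨l, hl.mono sdiff_subset, h1, h2⟩
  · by_cases hxT : x ∈ T
    · exact ⟨W, hWS, hWcl, hTW.1 hxT, hTN x hxT y hy hxy⟩
    by_cases hyT : y ∈ T
    · exact ⟨W, hWS, hWcl, hTN y hyT x hx hxy.symm, hTW.1 hyT⟩
    obtain ⟨D, hD, h1, h2⟩ := hct.2 x (mem_sdiff.2 ⟨hx, hxT⟩) y (mem_sdiff.2 ⟨hy, hyT⟩) hxy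
    exact ⟨D, hD.trans sdiff_subset, h1, h2⟩

/-! ### Paths and cliques in neighbourhoods -/

/-- Every path of `G` inside `S` has at most `m` vertices. -/
def PathOrderLE (G : SimpleGraph V) (S : Finset V) (m : ℕ) : Prop :=
  ∀ l, IsPathIn G S l → l.length ≤ m

/-- The **Erdős–Gallai theorem for paths**, for a set `S` with a common neighbour `v`: apply the
theorem for cycles to `S` together with `v`. -/
theorem PathOrderLE.sum_degIn_le {m : ℕ} (h : PathOrderLE G S m) {v : V}
    (hv : ∀ x ∈ S, G.Adj v x) (hm : 1 ≤ m) : ∑ x ∈ S, degIn G S x ≤ (m - 1) * #S := by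
  classical
  have hvS : v ∉ S := fun hvS => (hv v hvS).ne rfl
  have hcirc : CircumferenceLE G (insert v S) (m + 1) := by
    intro l hnd hlS hl3 hch
    by_cases hvl : v ∈ l
    · obtain ⟨A, B, rfl⟩ := List.append_of_mem hvl
      have hrot : (A ++ v :: B).IsRotated (v :: (B ++ A)) := by
        simpa using (List.isRotated_append (l := A) (l' := v :: B))
      rw [Cycle.coe_eq_coe.2 hrot, Cycle.chain_coe_cons] at hch
      rw [hrot.nodup_iff] at hnd
      have hp : IsPathIn G S (B ++ A) := by
        refine ⟨(List.nodup_cons.1 hnd).2, ?_, fun x hx => ?_⟩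
        · exact (List.isChain_append.1 (List.isChain_cons.1 hch).2).1
        · have := hlS x (hrot.perm.mem_iff.2 (List.mem_cons_of_mem _ hx))
          refine (mem_insert.1 this).resolve_left ?_
          rintro rfl
          exact (List.nodup_cons.1 hnd).1 hx
      have := h _ hp
      simp at this ⊢
      omega
    · obtain _ | ⟨a, l⟩ := l
      · simp at hl3
      rw [Cycle.chain_coe_cons, ← List.cons_append, List.isChain_append] at hch
      have := h (a :: l) ⟨hnd, hch.1, fun x hx => (mem_insert.1 (hlS x hx)).resolve_left (by
        rintro rfl; exact hvl hx)⟩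
      omega
  have key := (hcirc.sum_degIn_le (by omega) (insert_nonempty v S)).1
  rw [sum_degIn_eq_sdiff (T := {v}) (by simp)] at key
  have e : insert v S \ {v} = S := by
    ext x; simp only [mem_sdiff, mem_insert, mem_singleton]
    refine ⟨by tauto, fun hx => ⟨Or.inr hx, ?_⟩⟩
    rintro rfl; exact hvS hx
  have hd : degIn G S v = #S := by
    unfold degIn
    rw [filter_true_of_mem hv]
  have hd' := degIn_mono (G := G) (subset_insert v S) v
  rw [e, sum_singleton, card_insert_of_notMem hvS] at key
  obtain ⟨m, rfl⟩ : ∃ m', m = m' + 1 := ⟨m - 1, by omega⟩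
  simp only [Nat.add_sub_cancel]
  nlinarith

theorem PathOrderLE.inter_neighbors {m : ℕ} (h : PathOrderLE G S m) {x : V} (hx : x ∈ S)
    {N : Finset V} (hN : N ⊆ S) (hxN : ∀ y ∈ N, G.Adj x y) : PathOrderLE G N (m - 1) := by
  intro l hl
  have := h (x :: l) ((hl.mono hN).cons hx (fun hxl => (hxN x (hl.2.2 x hxl)).ne rfl)
    fun y hy => hxN y (hl.2.2 y (List.mem_of_mem_head? hy)))
  simp at this
  omega

/-- Paths in the neighbourhood of a vertex close to cycles through that vertex. -/
theorem CircumferenceLE.pathOrderLE (h : CircumferenceLE G S c) (hc : 2 ≤ c) {x : V} (hx : x ∈ S)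
    {N : Finset V} (hN : N ⊆ S) (hxN : ∀ y ∈ N, G.Adj x y) : PathOrderLE G N (c - 1) := by
  intro l hl
  obtain rfl | ⟨l', b, rfl⟩ := List.eq_nil_or_concat l
  · simp
  rw [List.concat_eq_append] at hl ⊢
  by_cases hl' : l' = []
  · simp [hl']; omega
  have := h.length_le ((hl.mono hN).cons hx (fun hxl => (hxN x (hl.2.2 x hxl)).ne rfl)
    fun y hy => hxN y (hl.2.2 y (List.mem_of_mem_head? hy))) hl' (hxN b (hl.2.2 b (by simp))).symm
  simp
  omega

/-- The vertex sets of the cliques of order `s` inside `S`. -/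
noncomputable def cliquesIn (G : SimpleGraph V) (S : Finset V) (s : ℕ) : Finset (Finset V) :=
  open Classical in {q ∈ S.powersetCard s | G.IsClique q}

theorem mem_cliquesIn {s : ℕ} {q : Finset V} :
    q ∈ cliquesIn G S s ↔ q ⊆ S ∧ G.IsNClique s q := by
  classical
  unfold cliquesIn
  rw [mem_filter, mem_powersetCard, SimpleGraph.isNClique_iff, and_assoc, and_comm (a := #q = s)]

open Classical in
/-- Cliques are counted through the cliques in the neighbourhoods of their vertices. -/
theorem card_cliquesIn_succ_le (S : Finset V) (s : ℕ) :
    (s + 1) * #(cliquesIn G S (s + 1)) ≤ ∑ x ∈ S, #(cliquesIn G {y ∈ S | G.Adj x y} s) := by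
  have h1 := sum_card_bipartiteAbove_eq_sum_card_bipartiteBelow (fun (x : V) (q : Finset V) => x ∈ q)
    (s := S) (t := cliquesIn G S (s + 1))
  have h2 : ∑ q ∈ cliquesIn G S (s + 1), #(bipartiteBelow (fun (x : V) (q : Finset V) => x ∈ q) S q)
      = (s + 1) * #(cliquesIn G S (s + 1)) := by
    rw [sum_congr rfl (g := fun _ => s + 1), sum_const, smul_eq_mul, mul_comm]
    intro q hq
    have hq' := mem_powersetCard.1 (mem_filter.1 hq).1
    rw [← hq'.2]
    congr 1
    ext x
    simp only [mem_bipartiteBelow]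
    exact ⟨And.right, fun hx => ⟨hq'.1 hx, hx⟩⟩
  rw [← h2, ← h1]
  refine sum_le_sum fun x hx => card_le_card_of_injOn (fun q => q.erase x) ?_ ?_
  · intro q hq
    obtain ⟨hq, hxq⟩ := (mem_bipartiteAbove _).1 hq
    obtain ⟨hq, hcl⟩ := mem_filter.1 hq
    obtain ⟨hqS, hqc⟩ := mem_powersetCard.1 hq
    refine mem_filter.2 ⟨mem_powersetCard.2 ⟨fun y hy => ?_, ?_⟩, ?_⟩
    · obtain ⟨hyx, hy⟩ := mem_erase.1 hy
      exact mem_filter.2 ⟨hqS hy, hcl hxq hy hyx.symm⟩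
    · rw [card_erase_of_mem hxq, hqc]; rfl
    · exact hcl.subset (by simp)
  · intro q hq q' hq' heq
    have hxq := ((mem_bipartiteAbove _).1 hq).2
    have hxq' := ((mem_bipartiteAbove _).1 hq').2
    dsimp only at heq
    rw [← insert_erase hxq, heq, insert_erase hxq']

/-- The number of cliques in a set with a common neighbour and no long path. Counting through
neighbourhoods lowers both `m` and `s` by one, and the vertex itself is a common neighbour of its
neighbourhood. -/
theorem PathOrderLE.card_cliquesIn_le {m s : ℕ} (h : PathOrderLE G S m) {v : V}
    (hv : ∀ x ∈ S, G.Adj v x) (hs : 1 ≤ s) : m * #(cliquesIn G S s) ≤ #S * m.choose s := by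
  classical
  induction s, hs using Nat.le_induction generalizing S m v with
  | base =>
    have : #(cliquesIn G S 1) ≤ #S :=
      (card_le_card (filter_subset (fun q : Finset V => G.IsClique q) (S.powersetCard 1))).trans
        (by simp)
    rw [Nat.choose_one_right, mul_comm]
    exact Nat.mul_le_mul_right _ this
  | succ s hs ih =>
    obtain _ | _ | m := m
    · simp
    · -- without paths on two vertices there are no edges
      have : cliquesIn G S (s + 1) = ∅ := by
        refine filter_eq_empty_iff.2 fun q hq hcl => ?_
        obtain ⟨hqS, hqc⟩ := mem_powersetCard.1 hq
        obtain ⟨a, ha, b, hb, hab⟩ := one_lt_card.1 (show 1 < #q by omega)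
        have := h [a, b] ⟨by simpa using hab, by simpa using hcl ha hb hab,
          by simp [hqS ha, hqS hb]⟩
        simp at this
      simp [this]
    have hsum : (m + 1) * ∑ x ∈ S, #(cliquesIn G {y ∈ S | G.Adj x y} s) ≤
        (∑ x ∈ S, degIn G S x) * (m + 1).choose s := by
      rw [mul_sum, sum_mul]
      refine sum_le_sum fun x hx => ?_
      have := ih (h.inter_neighbors hx (filter_subset (G.Adj x) S)
        fun y hy => (mem_filter.1 hy).2) (v := x) fun y hy => (mem_filter.1 hy).2
      simp only [Nat.add_sub_cancel] at this ⊢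
      exact this
    have hp := h.sum_degIn_le hv (by omega)
    have h1 := card_cliquesIn_succ_le (G := G) S s
    have h2 := Nat.add_one_mul_choose_eq (m + 1) s
    simp only [Nat.add_sub_cancel] at hp
    have h3 : (m + 1) * ((s + 1) * #(cliquesIn G S (s + 1))) ≤
        (m + 1) * (#S * (m + 1).choose s) := by
      calc _ ≤ _ := Nat.mul_le_mul_left _ h1
        _ ≤ _ := hsum
        _ ≤ ((m + 1) * #S) * (m + 1).choose s := Nat.mul_le_mul_right _ hp
        _ = _ := by ring
    have h4 := Nat.le_of_mul_le_mul_left h3 (by omega)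
    refine Nat.le_of_mul_le_mul_left (c := s + 1) ?_ (by omega)
    calc (s + 1) * ((m + 1 + 1) * #(cliquesIn G S (s + 1)))
        = (m + 1 + 1) * ((s + 1) * #(cliquesIn G S (s + 1))) := by ring
      _ ≤ (m + 1 + 1) * (#S * (m + 1).choose s) := Nat.mul_le_mul_left _ h4
      _ = #S * ((m + 1 + 1) * (m + 1).choose s) := by ring
      _ = #S * ((m + 1 + 1).choose (s + 1) * (s + 1)) := by rw [h2]
      _ = _ := by ring

/-- The number of cliques is bounded through the number of edges: neighbourhoods contain no long
paths. -/
theorem CircumferenceLE.card_cliquesIn_le {r : ℕ} (h : CircumferenceLE G S c) (hc : 2 ≤ c)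
    (hr : 2 ≤ r) : r * ((c - 1) * #(cliquesIn G S r)) ≤
      (∑ x ∈ S, degIn G S x) * (c - 1).choose (r - 1) := by
  classical
  obtain ⟨r, rfl⟩ : ∃ s, r = s + 1 := ⟨r - 1, by omega⟩
  calc (r + 1) * ((c - 1) * #(cliquesIn G S (r + 1)))
      = (c - 1) * ((r + 1) * #(cliquesIn G S (r + 1))) := by ring
    _ ≤ (c - 1) * _ := Nat.mul_le_mul_left _ (card_cliquesIn_succ_le S r)
    _ ≤ _ := by
      rw [mul_sum, sum_mul]
      refine sum_le_sum fun x hx => ?_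
      have := (h.pathOrderLE hc hx (filter_subset (G.Adj x) S)
        fun y hy => (mem_filter.1 hy).2).card_cliquesIn_le (v := x) (s := r)
        (fun y hy => (mem_filter.1 hy).2) (by omega)
      simp only [Nat.add_sub_cancel] at this ⊢
      exact this

end

section

variable {V : Type*} {H P : Finset (Finset V)} {g : Finset V → Finset V} {c : ℕ}

/-! ### Representing pairs by edges -/

/-- The graph whose edges are the two-element sets in `P`. -/
def pairGraph [DecidableEq V] (P : Finset (Finset V)) : SimpleGraph V where
  Adj x y := x ≠ y ∧ {x, y} ∈ P
  symm := ⟨fun x y h => ⟨h.1.symm, by rw [pair_comm]; exact h.2⟩⟩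
  loopless := ⟨fun _ h => h.1 rfl⟩

/-- `g` assigns to the pairs in `P` distinct edges of `H` that contain them. -/
def IsRepresentation (H P : Finset (Finset V)) (g : Finset V → Finset V) : Prop :=
  Set.InjOn g P ∧ ∀ p ∈ P, #p = 2 ∧ g p ∈ H ∧ p ⊆ g p

theorem IsRepresentation.mono {P' : Finset (Finset V)} (h : IsRepresentation H P g)
    (hP : P' ⊆ P) : IsRepresentation H P' g :=
  ⟨h.1.mono (by simpa using hP), fun p hp => h.2 p (hP hp)⟩

theorem sum_degIn_pairGraph [DecidableEq V] [Fintype V] (hP : ∀ p ∈ P, #p = 2) :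
    ∑ x, degIn (pairGraph P) univ x = 2 * #P := by
  classical
  have h1 := sum_card_bipartiteAbove_eq_sum_card_bipartiteBelow
    (fun (x : V) (q : Finset V) => x ∈ q) (s := univ) (t := P)
  have h2 : ∑ q ∈ P, #(bipartiteBelow (fun (x : V) (q : Finset V) => x ∈ q) univ q) = 2 * #P := by
    rw [sum_congr rfl (g := fun _ => 2), sum_const, smul_eq_mul, mul_comm]
    intro q hq
    rw [← hP q hq]
    congr 1
    ext x
    simp
  rw [← h2, ← h1]
  refine sum_congr rfl fun x _ => card_bij (fun y _ => {x, y}) ?_ ?_ ?_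
  · intro y hy
    have hy : (pairGraph P).Adj x y := (mem_filter.1 hy).2
    exact (mem_bipartiteAbove _).2 ⟨hy.2, by simp⟩
  · intro y hy z hz hyz
    have hy : (pairGraph P).Adj x y := (mem_filter.1 hy).2
    have : y ∈ ({x, z} : Finset V) := hyz ▸ (by simp)
    simpa [hy.1.symm] using this
  · intro p hp
    obtain ⟨hp, hxp⟩ := (mem_bipartiteAbove _).1 hp
    obtain ⟨a, b, hab, rfl⟩ := card_eq_two.1 (hP p hp)
    rcases mem_insert.1 hxp with rfl | hx
    · exact ⟨b, by simpa using ⟨hab, hp⟩, rfl⟩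
    · rw [mem_singleton] at hx
      subst hx
      exact ⟨a, by simpa [pairGraph, pair_comm] using ⟨hab.symm, hp⟩, pair_comm _ _⟩

/-- Consecutive vertices of a cyclic list, indexed as in `HasBergeCycle`. -/
theorem adj_finRotate_of_chain {G : SimpleGraph V} {l : List V} (hch : (l : Cycle V).Chain G.Adj)
    (i : Fin l.length) : G.Adj (l.get i) (l.get (finRotate _ i)) := by
  obtain _ | ⟨a, l⟩ := l
  · exact i.elim0
  rw [Cycle.chain_coe_cons, List.isChain_iff_getElem] at hch
  obtain ⟨i, hi⟩ := i
  simp only [List.length_cons] at hi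
  have h1 := hch i (by simp; omega)
  by_cases hil : i < l.length
  · have : finRotate (a :: l).length ⟨i, hi⟩ = ⟨i + 1, by simpa using hil⟩ := finRotate_of_lt hil
    rw [this]
    simp only [List.get_eq_getElem]
    have e : a :: (l ++ [a]) = (a :: l) ++ [a] := rfl
    simp only [e] at h1
    rwa [List.getElem_append_left (by simpa using hi),
      List.getElem_append_left (by simpa using hil)] at h1
  · obtain rfl : i = l.length := by omega
    have : finRotate (a :: l).length ⟨l.length, hi⟩ = ⟨0, by simp⟩ := finRotate_last'
    rw [this]
    simp only [List.get_eq_getElem]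
    have e : a :: (l ++ [a]) = (a :: l) ++ [a] := rfl
    simp only [e] at h1
    rw [List.getElem_append_left (by simp), List.getElem_append_right (by simp)] at h1
    simpa using h1

theorem finRotate_ne_of_eq_finRotate {N : ℕ} (hN : 3 ≤ N) {i j : Fin N} (hi : i = finRotate N j) :
    finRotate N i ≠ j := by
  intro hj
  obtain ⟨n, rfl⟩ : ∃ n, N = n + 1 := ⟨N - 1, by omega⟩
  have e1 := congrArg Fin.val hi
  have e2 := congrArg Fin.val hj
  rw [coe_finRotate] at e1 e2
  have := i.isLt
  have := j.isLt
  simp only [Fin.ext_iff, Fin.val_last] at e1 e2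
  split_ifs at e1 e2 <;> omega

/-- A cycle in a graph of represented pairs gives a Berge cycle of the same length. -/
theorem IsRepresentation.hasBergeCycle [DecidableEq V] (h : IsRepresentation H P g)
    {l : List V} (hnd : l.Nodup) (hl : 3 ≤ l.length) (hch : (l : Cycle V).Chain (pairGraph P).Adj) :
    HasBergeCycle H l.length := by
  have hadj := adj_finRotate_of_chain hch
  have hinj : Function.Injective l.get := List.nodup_iff_injective_get.1 hnd
  refine ⟨by omega, l.get, fun i => g {l.get i, l.get (finRotate _ i)}, hinj, ?_, fun i => ?_⟩
  · intro i j hij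
    have hpq := h.1 (hadj i).2 (hadj j).2 hij
    have hi : l.get i ∈ ({l.get j, l.get (finRotate _ j)} : Finset V) := hpq ▸ (by simp)
    have hi' : l.get (finRotate _ i) ∈ ({l.get j, l.get (finRotate _ j)} : Finset V) :=
      hpq ▸ (by simp)
    simp only [mem_insert, mem_singleton, hinj.eq_iff] at hi hi'
    rcases hi with hi | hi
    · exact hi
    rcases hi' with hi' | hi'
    · -- `i` and `j` would follow each other, in a cycle of length at least three
      exact (finRotate_ne_of_eq_finRotate hl hi hi').elim
    · exact (finRotate _).injective hi'
  · obtain ⟨-, h1, h2⟩ := h.2 _ (hadj i).2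
    exact ⟨h1, h2 (by simp), h2 (by simp)⟩

theorem IsRepresentation.circumferenceLE [DecidableEq V] (h : IsRepresentation H P g)
    (hcycle : ∀ ℓ, c < ℓ → ¬ HasBergeCycle H ℓ) (S : Finset V) :
    CircumferenceLE (pairGraph P) S c := by
  intro l hnd _ h3 hch
  by_contra! hlt
  exact hcycle _ hlt (h.hasBergeCycle hnd h3 hch)

/-- Hall's marriage theorem for a finite subset of a type. -/
theorem exists_injOn_of_card_le_biUnion {α β : Type*} [DecidableEq β] [Inhabited β]
    (s : Finset α) (t : α → Finset β) (h : ∀ X ⊆ s, #X ≤ #(X.biUnion t)) :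
    ∃ f : α → β, Set.InjOn f s ∧ ∀ x ∈ s, f x ∈ t x := by
  classical
  obtain ⟨f, hf, hft⟩ := (all_card_le_biUnion_card_iff_exists_injective (fun x : s => t x)).1
    fun X => by
      have := h (X.map (Function.Embedding.subtype _)) (map_subtype_subset X)
      rwa [card_map, map_eq_image, image_biUnion] at this
  refine ⟨fun x => if hx : x ∈ s then f ⟨x, hx⟩ else default, fun x hx y hy hxy => ?_,
    fun x hx => ?_⟩
  · have hx' : x ∈ s := hx
    have hy' : y ∈ s := hy
    simp only [hx', hy', dite_true] at hxy
    exact congrArg Subtype.val (hf hxy)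
  · simpa [hx] using hft ⟨x, hx⟩

/-- Every family `H` splits into a subfamily `H₁` and its complement such that all pairs in edges
of `H₁` can be represented by distinct edges of `H₁`, and all remaining edges represent distinct
further pairs. `H₁` is a subfamily with the largest excess of its size over the number of pairs
covered by it; maximality gives Hall's condition for both parts. -/
theorem exists_representation [DecidableEq V] (H : Finset (Finset V)) :
    ∃ H₁ ⊆ H, ∃ (P₁ P₂ : Finset (Finset V)) (g : Finset V → Finset V), Disjoint P₁ P₂ ∧
      IsRepresentation H (P₁ ∪ P₂) g ∧ P₂.image g = H \ H₁ ∧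
        ∀ e ∈ H₁, e.powersetCard 2 ⊆ P₁ := by
  obtain ⟨H₁, hH₁, hmax⟩ := exists_max_image H.powerset
    (fun X => (#X : ℤ) - #(X.biUnion (powersetCard 2))) ⟨∅, by simp⟩
  rw [mem_powerset] at hH₁
  set P₁ := H₁.biUnion (powersetCard 2) with hP₁
  obtain ⟨f, hf, hft⟩ := exists_injOn_of_card_le_biUnion (H \ H₁)
    (fun e => e.powersetCard 2 \ P₁) fun X hX => by
      have hXd : Disjoint H₁ X := disjoint_of_subset_right hX disjoint_sdiff
      have h1 := hmax (H₁ ∪ X) (mem_powerset.2 (union_subset hH₁ (hX.trans sdiff_subset)))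
      have h2 : X.biUnion (fun e => e.powersetCard 2 \ P₁) =
          X.biUnion (powersetCard 2) \ P₁ := by
        ext p; simp only [mem_biUnion, mem_sdiff]; tauto
      have h3 := card_sdiff_add_card (X.biUnion (powersetCard 2)) P₁
      rw [union_biUnion, ← hP₁, card_union_of_disjoint hXd, union_comm] at h1
      rw [h2]
      push_cast at h1
      omega
  obtain ⟨g₁, hg₁, hgt⟩ := exists_injOn_of_card_le_biUnion P₁ (fun p => {e ∈ H₁ | p ⊆ e})
    fun Y hY => by
      set N := Y.biUnion (fun p => {e ∈ H₁ | p ⊆ e}) with hN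
      have hNH : N ⊆ H₁ := biUnion_subset.2 fun p _ => filter_subset _ _
      have h1 := hmax (H₁ \ N) (mem_powerset.2 (sdiff_subset.trans hH₁))
      have h2 : (H₁ \ N).biUnion (powersetCard 2) ⊆ P₁ \ Y := by
        intro p hp
        obtain ⟨e, he, hpe⟩ := mem_biUnion.1 hp
        obtain ⟨he1, heN⟩ := mem_sdiff.1 he
        refine mem_sdiff.2 ⟨mem_biUnion.2 ⟨e, he1, hpe⟩, fun hpY => heN ?_⟩
        exact mem_biUnion.2 ⟨p, hpY, mem_filter.2 ⟨he1, (mem_powersetCard.1 hpe).1⟩⟩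
      have h3 := card_le_card h2
      rw [card_sdiff_of_subset hY] at h3
      have h4 := card_le_card hY
      have h5 := card_le_card hNH
      rw [card_sdiff_of_subset hNH] at h1
      omega
  set P₂ := (H \ H₁).image f with hP₂
  have hfP : ∀ e ∈ H \ H₁, f e ∉ P₁ := fun e he => (mem_sdiff.1 (hft e he)).2
  -- `P₂` is represented by inverting `f`
  let f' : Finset V → Finset V := Function.invFunOn f (H \ H₁ : Finset (Finset V))
  have hf' : ∀ e ∈ H \ H₁, f' (f e) = e := fun e he => hf.leftInvOn_invFunOn he
  let g : Finset V → Finset V := fun p => if p ∈ P₁ then g₁ p else f' p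
  have hg1 : ∀ p ∈ P₁, g p = g₁ p := fun p hp => if_pos hp
  have hg2 : ∀ e ∈ H \ H₁, g (f e) = e := fun e he => (if_neg (hfP e he)).trans (hf' e he)
  refine ⟨H₁, hH₁, P₁, P₂, g, ?_, ⟨?_, ?_⟩, ?_, fun e he p hp => mem_biUnion.2 ⟨e, he, hp⟩⟩
  · rw [disjoint_right]
    intro p hp
    obtain ⟨e, he, rfl⟩ := mem_image.1 hp
    exact hfP e he
  · intro p hp q hq hpq
    have hcross : ∀ p ∈ P₁, ∀ e ∈ H \ H₁, g p ≠ g (f e) := by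
      intro p hp e he heq
      rw [hg1 p hp, hg2 e he] at heq
      exact (mem_sdiff.1 he).2 (heq ▸ (mem_filter.1 (hgt p hp)).1)
    rcases mem_union.1 hp with hp | hp <;> rcases mem_union.1 hq with hq | hq
    · rw [hg1 p hp, hg1 q hq] at hpq
      exact hg₁ hp hq hpq
    · obtain ⟨e, he, rfl⟩ := mem_image.1 hq
      exact (hcross p hp e he hpq).elim
    · obtain ⟨e, he, rfl⟩ := mem_image.1 hp
      exact (hcross q hq e he hpq.symm).elim
    · obtain ⟨e, he, rfl⟩ := mem_image.1 hp
      obtain ⟨e', he', rfl⟩ := mem_image.1 hq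
      rw [hg2 e he, hg2 e' he'] at hpq
      rw [hpq]
  · intro p hp
    rcases mem_union.1 hp with hp | hp
    · obtain ⟨e, -, hpe⟩ := mem_biUnion.1 hp
      have := mem_filter.1 (hgt p hp)
      rw [hg1 p hp]
      exact ⟨(mem_powersetCard.1 hpe).2, hH₁ this.1, this.2⟩
    · obtain ⟨e, he, rfl⟩ := mem_image.1 hp
      have := mem_powersetCard.1 (mem_sdiff.1 (hft e he)).1
      rw [hg2 e he]
      exact ⟨this.2, (mem_sdiff.1 he).1, this.1⟩
  · rw [hP₂, image_image]
    conv_rhs => rw [← image_id (s := H \ H₁)]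
    exact image_congr fun e he => hg2 e he

end

section

variable {V : Type*} {H P : Finset (Finset V)} {g : Finset V → Finset V} {c r : ℕ}

/-! ### The bound and its extremal hypergraphs -/

/-- With `n = c - 1` and `j = r - 1` this says that a clique of order `c` has at least as many
`r`-subsets as pairs. Equality occurs for `j + 2 = n`. -/
theorem add_one_mul_le_two_mul_choose {n j : ℕ} (hj : 2 ≤ j) (hn : j + 2 ≤ n) :
    (j + 1) * n ≤ 2 * n.choose j := by
  induction n, hn using Nat.le_induction with
  | base =>
    rw [← Nat.choose_symm_of_eq_add (show j + 2 = 2 + j by ring), Nat.choose_two_right]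
    have : 2 ∣ (j + 2) * (j + 2 - 1) := (Nat.even_mul_pred_self (j + 2)).two_dvd
    rw [Nat.mul_div_cancel' this, mul_comm]
    rfl
  | succ n hn ih =>
    have h := Nat.choose_mul_succ_eq n j
    refine Nat.le_of_mul_le_mul_right (c := n + 1 - j) ?_ (by omega)
    calc (j + 1) * (n + 1) * (n + 1 - j) ≤ (j + 1) * (n + 1) * n :=
          Nat.mul_le_mul_left _ (by omega)
      _ = ((j + 1) * n) * (n + 1) := by ring
      _ ≤ (2 * n.choose j) * (n + 1) := Nat.mul_le_mul_right _ ih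
      _ = 2 * (n.choose j * (n + 1)) := by ring
      _ = 2 * (n + 1).choose j * (n + 1 - j) := by rw [h]; ring

/-- The Erdős–Gallai theorem for the graph of represented pairs. -/
theorem IsRepresentation.two_mul_card_le [DecidableEq V] [Fintype V] [Nonempty V]
    (h : IsRepresentation H P g) (hc : 2 ≤ c) (hcycle : ∀ ℓ, c < ℓ → ¬ HasBergeCycle H ℓ) :
    2 * #P + c ≤ c * Fintype.card V ∧
      (2 * #P + c = c * Fintype.card V → CliqueTree (pairGraph P) univ c) := by
  have := (h.circumferenceLE hcycle univ).sum_degIn_le hc univ_nonempty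
  rwa [sum_degIn_pairGraph fun p hp => (h.2 p hp).1, card_univ] at this

/-- The edges whose pairs are all represented are cliques in the graph of represented pairs. Every
remaining edge represents a pair, and a pair contributes at least as much to the bound. -/
theorem mul_card_le_of_split [DecidableEq V] [Fintype V] (hr : 3 ≤ r) (hrc : r + 2 ≤ c)
    (hH : (H : Set (Finset V)).Sized r) (hcycle : ∀ ℓ, c < ℓ → ¬ HasBergeCycle H ℓ)
    {H₁ P₁ P₂ : Finset (Finset V)} (hH₁ : H₁ ⊆ H) (hd : Disjoint P₁ P₂)
    (hrep : IsRepresentation H (P₁ ∪ P₂) g) (hP₂ : P₂.image g = H \ H₁)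
    (hP₁ : ∀ e ∈ H₁, e.powersetCard 2 ⊆ P₁) :
    r * ((c - 1) * #H) ≤ 2 * #(P₁ ∪ P₂) * (c - 1).choose (r - 1) := by
  have hr1 := hrep.mono (P' := P₁) subset_union_left
  have h1 := (hr1.circumferenceLE hcycle univ).card_cliquesIn_le (r := r) (by omega) (by omega)
  rw [sum_degIn_pairGraph fun p hp => (hr1.2 p hp).1] at h1
  have h2 : #H₁ ≤ #(cliquesIn (pairGraph P₁) univ r) := by
    refine card_le_card fun e he => mem_cliquesIn.2
      ⟨subset_univ _, fun x hx y hy hxy => ⟨hxy, ?_⟩, hH (hH₁ he)⟩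
    exact hP₁ e he (mem_powersetCard.2 ⟨by simp [insert_subset_iff, mem_coe.1 hx, mem_coe.1 hy],
      card_pair hxy⟩)
  have h3 : #H - #H₁ ≤ #P₂ := by
    rw [← card_sdiff_of_subset hH₁, ← hP₂]
    exact card_image_le
  have h4 : r * (c - 1) ≤ 2 * (c - 1).choose (r - 1) := by
    have := add_one_mul_le_two_mul_choose (n := c - 1) (j := r - 1) (by omega) (by omega)
    rwa [Nat.sub_add_cancel (by omega)] at this
  rw [card_union_of_disjoint hd]
  calc r * ((c - 1) * #H) ≤ r * ((c - 1) * (#(cliquesIn (pairGraph P₁) univ r) + #P₂)) := by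
        gcongr; omega
    _ = r * ((c - 1) * #(cliquesIn (pairGraph P₁) univ r)) + r * (c - 1) * #P₂ := by ring
    _ ≤ 2 * #P₁ * (c - 1).choose (r - 1) + 2 * (c - 1).choose (r - 1) * #P₂ :=
        add_le_add h1 (Nat.mul_le_mul_right _ h4)
    _ = _ := by ring

theorem mul_choose_pred (hr : 1 ≤ r) (hc : 1 ≤ c) :
    c * (c - 1).choose (r - 1) = r * c.choose r := by
  obtain ⟨c, rfl⟩ : ∃ c', c = c' + 1 := ⟨c - 1, by omega⟩
  obtain ⟨r, rfl⟩ : ∃ r', r = r' + 1 := ⟨r - 1, by omega⟩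
  simp only [Nat.add_sub_cancel]
  rw [Nat.add_one_mul_choose_eq, mul_comm]

/-- The upper bound, in integers: `(c - 1) |H| ≤ (|V| - 1) (c choose r)`. -/
theorem mul_card_add_choose_le [DecidableEq V] [Fintype V] [Nonempty V] (hr : 3 ≤ r)
    (hrc : r + 2 ≤ c) (hH : (H : Set (Finset V)).Sized r)
    (hcycle : ∀ ℓ, c < ℓ → ¬ HasBergeCycle H ℓ) :
    (c - 1) * #H + c.choose r ≤ Fintype.card V * c.choose r := by
  obtain ⟨H₁, hH₁, P₁, P₂, g, hd, hrep, hP₂, hP₁⟩ := exists_representation H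
  have h1 := mul_card_le_of_split hr hrc hH hcycle hH₁ hd hrep hP₂ hP₁
  have h2 := (hrep.two_mul_card_le (by omega) hcycle).1
  have h3 := mul_choose_pred (r := r) (c := c) (by omega) (by omega)
  refine Nat.le_of_mul_le_mul_left (c := r) ?_ (by omega)
  calc r * ((c - 1) * #H + c.choose r)
      = r * ((c - 1) * #H) + r * c.choose r := by ring
    _ ≤ 2 * #(P₁ ∪ P₂) * (c - 1).choose (r - 1) + r * c.choose r := by gcongr
    _ = (2 * #(P₁ ∪ P₂) + c) * (c - 1).choose (r - 1) := by rw [← h3]; ring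
    _ ≤ (c * Fintype.card V) * (c - 1).choose (r - 1) := by gcongr
    _ = Fintype.card V * (c * (c - 1).choose (r - 1)) := by ring
    _ = _ := by rw [h3]; ring

/-- In an extremal representation no edge `g p` contains a pair `w z` that is not represented.
Otherwise `p` could be replaced by this pair. The new representation is extremal too, so in its
graph an edge of the former clique at `p` other than `p` lies in a clique of order `c`. This
contains the whole former clique, and with it the missing pair `p`. -/
theorem IsRepresentation.pair_mem [DecidableEq V] [Fintype V] [Nonempty V]
    (h : IsRepresentation H P g) (hc : 4 ≤ c) (hcycle : ∀ ℓ, c < ℓ → ¬ HasBergeCycle H ℓ)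
    (hcard : 2 * #P + c = c * Fintype.card V) {p : Finset V} (hp : p ∈ P) {w z : V}
    (hw : w ∈ g p) (hz : z ∈ g p) (hwz : w ≠ z) : {w, z} ∈ P := by
  by_contra hwzP
  set P' := insert {w, z} (P.erase p) with hP'
  have hnot : ({w, z} : Finset V) ∉ P.erase p := fun hmem => hwzP (mem_of_mem_erase hmem)
  have hrep : IsRepresentation H P' (Function.update g {w, z} (g p)) := by
    have hupd : ∀ q ∈ P.erase p, Function.update g {w, z} (g p) q = g q := fun q hq =>
      Function.update_of_ne (by rintro rfl; exact hnot hq) _ _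
    have hne : ∀ q ∈ P.erase p, g q ≠ g p := fun q hq heq =>
      (mem_erase.1 hq).1 (h.1 (mem_erase.1 hq).2 hp heq)
    refine ⟨fun q hq q' hq' heq => ?_, fun q hq => ?_⟩
    · rcases mem_insert.1 hq with rfl | hq <;> rcases mem_insert.1 hq' with rfl | hq'
      · rfl
      · rw [Function.update_self, hupd q' hq'] at heq
        exact (hne q' hq' heq.symm).elim
      · rw [Function.update_self, hupd q hq] at heq
        exact (hne q hq heq).elim
      · rw [hupd q hq, hupd q' hq'] at heq
        exact h.1 (mem_of_mem_erase hq) (mem_of_mem_erase hq') heq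
    · rcases mem_insert.1 hq with rfl | hq
      · rw [Function.update_self]
        exact ⟨card_pair hwz, (h.2 p hp).2.1, by simp [insert_subset_iff, hw, hz]⟩
      · rw [hupd q hq]
        exact h.2 q (mem_of_mem_erase hq)
  have hcard' : #P' = #P := by
    rw [hP', card_insert_of_notMem hnot, card_erase_of_mem hp]
    have := card_pos.2 ⟨p, hp⟩
    omega
  have ht := (h.two_mul_card_le (by omega) hcycle).2 hcard
  have ht' := (hrep.two_mul_card_le (by omega) hcycle).2 (by rw [hcard', hcard])
  have hcirc := hrep.circumferenceLE hcycle univ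
  obtain ⟨x, y, hxy, rfl⟩ := card_eq_two.1 (h.2 p hp).1
  obtain ⟨D, -, hD, hxD, hyD⟩ := ht.2 x (mem_univ _) y (mem_univ _) ⟨hxy, hp⟩
  have hadj : ∀ a ∈ D, ∀ b ∈ D, a ≠ b → ({a, b} : Finset V) ≠ {x, y} → (pairGraph P').Adj a b :=
    fun a ha b hb hab hne =>
      ⟨hab, mem_insert_of_mem (mem_erase.2 ⟨hne, (hD.1 ha hb hab).2⟩)⟩
  obtain ⟨u, hu, u', hu', huu⟩ := one_lt_card.1 (show 1 < #((D.erase x).erase y) by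
    rw [card_erase_of_mem (mem_erase.2 ⟨hxy.symm, hyD⟩), card_erase_of_mem hxD, hD.2]
    omega)
  simp only [mem_erase] at hu hu'
  have hpair : ∀ a b v : V, v ≠ x → v ≠ y → v ∈ ({a, b} : Finset V) →
      ({a, b} : Finset V) ≠ {x, y} := by
    intro a b v hvx hvy hv heq
    rw [heq] at hv
    simp [hvx, hvy] at hv
  have hxu := hadj x hxD u hu.2.2 (Ne.symm hu.2.1) (hpair _ _ u hu.2.1 hu.1 (by simp))
  obtain ⟨D', hD'S, hD', hxD', huD'⟩ := ht'.2 x (mem_univ _) u (mem_univ _) hxu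
  have hu'D' : u' ∈ D' := hcirc.mem_of_adj_of_adj hD' hD'S hxD' huD' (Ne.symm hu.2.1)
    (mem_univ _)
    (hadj x hxD u' hu'.2.2 (Ne.symm hu'.2.1) (hpair _ _ u' hu'.2.1 hu'.1 (by simp)))
    (hadj u hu.2.2 u' hu'.2.2 huu (hpair _ _ u hu.2.1 hu.1 (by simp)))
  have hyD' : y ∈ D' := hcirc.mem_of_adj_of_adj hD' hD'S huD' hu'D' huu (mem_univ _)
    (hadj u hu.2.2 y hyD hu.1 (hpair _ _ u hu.2.1 hu.1 (by simp)))
    (hadj u' hu'.2.2 y hyD hu'.1 (hpair _ _ u' hu'.2.1 hu'.1 (by simp)))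
  rcases mem_insert.1 (hD'.1 hxD' hyD' hxy).2 with heq | hmem
  · exact hwzP (heq ▸ hp)
  · exact (mem_erase.1 hmem).1 rfl

/-- Two distinct cliques of order `c` share at most one vertex. -/
theorem CircumferenceLE.eq_of_isNClique {G : SimpleGraph V} {S : Finset V}
    (h : CircumferenceLE G S c) {D D' : Finset V} (hD : G.IsNClique c D) (hD' : G.IsNClique c D')
    (hDS : D ⊆ S) (hDS' : D' ⊆ S) {a b : V} (hab : a ≠ b) (ha : a ∈ D) (hb : b ∈ D)
    (ha' : a ∈ D') (hb' : b ∈ D') : D = D' := by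
  refine (eq_of_subset_of_card_le (fun z hz => ?_) (by rw [hD.2, hD'.2])).symm
  by_cases hza : z = a
  · rwa [hza]
  by_cases hzb : z = b
  · rwa [hzb]
  exact h.mem_of_adj_of_adj hD hDS ha hb hab (hDS' hz) (hD'.1 ha' hz (Ne.symm hza))
    (hD'.1 hb' hz (Ne.symm hzb))

theorem pairwiseDisjoint_powersetCard [DecidableEq V] {𝒟 : Finset (Finset V)} {s : ℕ} (hs : 2 ≤ s)
    (h : ∀ D ∈ 𝒟, ∀ D' ∈ 𝒟, ∀ a b : V, a ≠ b → a ∈ D → b ∈ D → a ∈ D' → b ∈ D' → D = D') :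
    (𝒟 : Set (Finset V)).PairwiseDisjoint (powersetCard s) := by
  intro D hD D' hD' hne
  rw [Function.onFun, Finset.disjoint_left]
  intro q hq hq'
  obtain ⟨hqD, hqc⟩ := mem_powersetCard.1 hq
  have hqD' := (mem_powersetCard.1 hq').1
  obtain ⟨a, ha, b, hb, hab⟩ := one_lt_card.1 (show 1 < #q by omega)
  exact hne (h D hD D' hD' a b hab (hqD ha) (hqD hb) (hqD' ha) (hqD' hb))

theorem card_biUnion_powersetCard [DecidableEq V] {𝒟 : Finset (Finset V)} {s : ℕ} (hs : 2 ≤ s)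
    (hc : ∀ D ∈ 𝒟, #D = c)
    (h : ∀ D ∈ 𝒟, ∀ D' ∈ 𝒟, ∀ a b : V, a ≠ b → a ∈ D → b ∈ D → a ∈ D' → b ∈ D' → D = D') :
    #(𝒟.biUnion (powersetCard s)) = #𝒟 * c.choose s := by
  rw [card_biUnion (pairwiseDisjoint_powersetCard hs h),
    sum_congr rfl fun D hD => by rw [card_powersetCard, hc D hD], sum_const, smul_eq_mul]

/-- In a hypergraph with the extremal number of edges, the shadow is a tree of cliques of order
`c`, all of whose `r`-subsets are edges. -/
theorem extremal_structure [DecidableEq V] [Fintype V] [Nonempty V] (hr : 3 ≤ r)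
    (hrc : r + 2 ≤ c) (hH : (H : Set (Finset V)).Sized r)
    (hcycle : ∀ ℓ, c < ℓ → ¬ HasBergeCycle H ℓ)
    (heq : (c - 1) * #H + c.choose r = Fintype.card V * c.choose r) :
    CircumferenceLE (twoShadow H) univ c ∧ CliqueTree (twoShadow H) univ c ∧
      ∀ D, (twoShadow H).IsNClique c D → D.powersetCard r ⊆ H := by
  classical
  obtain ⟨H₁, hH₁, P₁, P₂, g, hd, hrep, hP₂, hP₁⟩ := exists_representation H
  have h1 := mul_card_le_of_split hr hrc hH hcycle hH₁ hd hrep hP₂ hP₁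
  have h2 := hrep.two_mul_card_le (by omega) hcycle
  have h3 := mul_choose_pred (r := r) (c := c) (by omega) (by omega)
  have hcirc := hrep.circumferenceLE hcycle univ
  have hsub : P₁ ⊆ P₁ ∪ P₂ := subset_union_left
  have hsub₂ : P₂ ⊆ P₁ ∪ P₂ := subset_union_right
  set P := P₁ ∪ P₂
  have hPcard : 2 * #P + c = c * Fintype.card V := by
    refine le_antisymm h2.1 ?_
    refine Nat.le_of_mul_le_mul_right (c := (c - 1).choose (r - 1)) ?_
      (Nat.choose_pos (by omega))
    calc c * Fintype.card V * (c - 1).choose (r - 1)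
        = Fintype.card V * (c * (c - 1).choose (r - 1)) := by ring
      _ = r * (Fintype.card V * c.choose r) := by rw [h3]; ring
      _ = r * ((c - 1) * #H) + c * (c - 1).choose (r - 1) := by rw [← heq, h3]; ring
      _ ≤ 2 * #P * (c - 1).choose (r - 1) + c * (c - 1).choose (r - 1) := by gcongr
      _ = _ := by ring
  have htree := h2.2 hPcard
  have hclique : ∀ e ∈ H, ∀ x ∈ e, ∀ y ∈ e, x ≠ y → {x, y} ∈ P := by
    intro e he x hx y hy hxy
    by_cases he₁ : e ∈ H₁
    · exact hsub (hP₁ e he₁ (mem_powersetCard.2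
        ⟨by simp [insert_subset_iff, hx, hy], card_pair hxy⟩))
    · have : e ∈ P₂.image g := by rw [hP₂]; exact mem_sdiff.2 ⟨he, he₁⟩
      obtain ⟨p, hp, rfl⟩ := mem_image.1 this
      exact hrep.pair_mem (by omega) hcycle hPcard (hsub₂ hp) hx hy hxy
  set G := pairGraph P
  set 𝒟 := cliquesIn G univ c with h𝒟
  have hmem : ∀ D, D ∈ 𝒟 ↔ G.IsNClique c D := by
    simp [h𝒟, mem_cliquesIn]
  have hdisj : ∀ D ∈ 𝒟, ∀ D' ∈ 𝒟, ∀ a b : V, a ≠ b → a ∈ D → b ∈ D → a ∈ D' → b ∈ D' →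
      D = D' := fun D hD D' hD' a b hab ha hb ha' hb' =>
    hcirc.eq_of_isNClique ((hmem D).1 hD) ((hmem D').1 hD') (subset_univ _) (subset_univ _) hab
      ha hb ha' hb'
  have hHsub : H ⊆ 𝒟.biUnion (powersetCard r) := by
    intro e he
    have hec : #e = r := hH he
    obtain ⟨a, ha, b, hb, hab⟩ := one_lt_card.1 (show 1 < #e by omega)
    obtain ⟨D, hDS, hD, haD, hbD⟩ := htree.2 a (mem_univ _) b (mem_univ _)
      ⟨hab, hclique e he a ha b hb hab⟩
    refine mem_biUnion.2 ⟨D, (hmem D).2 hD, mem_powersetCard.2 ⟨fun z hz => ?_, hec⟩⟩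
    by_cases hza : z = a
    · rwa [hza]
    by_cases hzb : z = b
    · rwa [hzb]
    exact hcirc.mem_of_adj_of_adj hD hDS haD hbD hab (mem_univ _)
      ⟨Ne.symm hza, hclique e he a ha z hz (Ne.symm hza)⟩
      ⟨Ne.symm hzb, hclique e he b hb z hz (Ne.symm hzb)⟩
  have hPeq : P = 𝒟.biUnion (powersetCard 2) := by
    ext p
    constructor
    · intro hp
      obtain ⟨x, y, hxy, rfl⟩ := card_eq_two.1 (hrep.2 p hp).1
      obtain ⟨D, -, hD, hxD, hyD⟩ := htree.2 x (mem_univ _) y (mem_univ _) ⟨hxy, hp⟩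
      exact mem_biUnion.2 ⟨D, (hmem D).2 hD, mem_powersetCard.2
        ⟨by simp [insert_subset_iff, hxD, hyD], card_pair hxy⟩⟩
    · intro hp
      obtain ⟨D, hD, hpD⟩ := mem_biUnion.1 hp
      obtain ⟨hpD, hpc⟩ := mem_powersetCard.1 hpD
      obtain ⟨x, y, hxy, rfl⟩ := card_eq_two.1 hpc
      exact (((hmem D).1 hD).1 (hpD (by simp)) (hpD (by simp)) hxy).2
  have hsize : ∀ D ∈ 𝒟, #D = c := fun D hD => ((hmem D).1 hD).2
  have hcount : #𝒟 * (c - 1) + 1 = Fintype.card V := by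
    have hP2 := card_biUnion_powersetCard (s := 2) le_rfl hsize hdisj
    rw [← hPeq] at hP2
    have hc2 : c.choose 2 * 2 = c * (c - 1) := by
      rw [Nat.choose_two_right, Nat.div_mul_cancel (Nat.even_mul_pred_self c).two_dvd]
    refine Nat.eq_of_mul_eq_mul_left (show 0 < c by omega) ?_
    rw [← hPcard, hP2]
    calc c * (#𝒟 * (c - 1) + 1) = #𝒟 * (c * (c - 1)) + c := by ring
      _ = _ := by rw [← hc2]; ring
  have hHeq : H = 𝒟.biUnion (powersetCard r) := by
    refine eq_of_subset_of_card_le hHsub ?_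
    rw [card_biUnion_powersetCard (by omega) hsize hdisj]
    refine Nat.le_of_mul_le_mul_left (c := c - 1) ?_ (by omega)
    refine Nat.le_of_add_le_add_right (b := c.choose r) ?_
    rw [heq, ← hcount]
    exact le_of_eq (by ring)
  have hshadow : twoShadow H = G := by
    ext x y
    constructor
    · rintro ⟨hxy, e, he, hx, hy⟩
      exact ⟨hxy, hclique e he x hx y hy hxy⟩
    · rintro hadj
      obtain ⟨D, -, hD, hxD, hyD⟩ := htree.2 x (mem_univ _) y (mem_univ _) hadj
      obtain ⟨e, hxe, heD, hec⟩ := exists_subsuperset_card_eq (s := {x, y}) (t := D) (n := r)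
        (by simp [insert_subset_iff, hxD, hyD]) (by rw [card_pair hadj.ne]; omega)
        (by rw [hD.2]; omega)
      refine ⟨hadj.ne, e, ?_, hxe (by simp), hxe (by simp)⟩
      rw [hHeq]
      exact mem_biUnion.2 ⟨D, (hmem D).2 hD, mem_powersetCard.2 ⟨heD, hec⟩⟩
  rw [hshadow]
  refine ⟨hcirc, htree, fun D hD e he => ?_⟩
  rw [hHeq]
  exact mem_biUnion.2 ⟨D, (hmem D).2 hD, he⟩

end

section

variable {V : Type*} {G : SimpleGraph V} {c r : ℕ}

/-! ### Blocks -/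

theorem connected_induce_of_isClique {s : Set V} (h : G.IsClique s) (hs : s.Nonempty) :
    (G.induce s).Connected := by
  have : Nonempty s := hs.to_subtype
  refine ⟨fun a b => ?_⟩
  by_cases hab : a = b
  · rw [hab]
  · exact SimpleGraph.Adj.reachable (h a.2 b.2 fun h => hab (Subtype.ext h))

theorem isNonseparable_of_isNClique {D : Finset V} (h : G.IsNClique c D) (hc : 2 ≤ c) :
    IsNonseparable G D := by
  have h2 : 2 ≤ #D := by rw [h.2]; exact hc
  refine ⟨h2, connected_induce_of_isClique h.1 (card_pos.1 (by omega)), fun v _ => ?_⟩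
  obtain ⟨b, hb, hbv⟩ := exists_mem_ne (show 1 < #D by omega) v
  exact connected_induce_of_isClique (h.1.subset Set.sdiff_subset) ⟨b, hb, hbv⟩

theorem IsNonseparable.union [DecidableEq V] {D D' : Finset V} (h : IsNonseparable G D)
    (h' : IsNonseparable G D') {a b : V} (hab : a ≠ b) (ha : a ∈ D) (hb : b ∈ D) (ha' : a ∈ D')
    (hb' : b ∈ D') : IsNonseparable G (D ∪ D') := by
  have hdel : ∀ X : Finset V, IsNonseparable G X → ∀ v,
      (G.induce ((X : Set V) \ {v})).Connected := by
    intro X hX v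
    by_cases hv : v ∈ X
    · exact hX.2.2 v hv
    · rw [Set.sdiff_singleton_eq_self (by simpa using hv)]
      exact hX.2.1
  refine ⟨h.1.trans (card_le_card subset_union_left), ?_, fun v _ => ?_⟩
  · rw [coe_union]
    exact SimpleGraph.induce_union_connected h.2.1.preconnected h'.2.1.preconnected ⟨a, ha, ha'⟩
  · rw [coe_union, Set.union_sdiff_distrib]
    refine SimpleGraph.induce_union_connected (hdel D h v).preconnected
      (hdel D' h' v).preconnected ?_
    by_cases hav : a = v
    · exact ⟨b, ⟨hb, fun h => hab (hav.trans h.symm)⟩, ⟨hb', fun h => hab (hav.trans h.symm)⟩⟩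
    · exact ⟨a, ⟨ha, hav⟩, ⟨ha', hav⟩⟩

theorem exists_isPathIn_of_connected {s : Set V} (h : (G.induce s).Connected) {a b : V}
    (ha : a ∈ s) (hb : b ∈ s) : ∃ l : List V, l.Nodup ∧ l.IsChain G.Adj ∧ (∀ x ∈ l, x ∈ s) ∧
      l.head? = some a ∧ b ∈ l := by
  classical
  obtain ⟨p, hp⟩ := (h.preconnected ⟨a, ha⟩ ⟨b, hb⟩).exists_isPath
  refine ⟨p.support.map Subtype.val, hp.support_nodup.map Subtype.val_injective, ?_, ?_, ?_, ?_⟩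
  · exact List.isChain_map _ |>.2 (p.isChain_adj_support.imp fun _ _ h => h)
  · rintro _ hx
    obtain ⟨x, -, rfl⟩ := List.mem_map.1 hx
    exact x.2
  · rw [List.head?_map, ← List.cons_head_tail p.support_ne_nil, p.head_support]; rfl
  · simp [hb]

theorem exists_eq_append_of_first (p : V → Prop) : ∀ l : List V, (∃ x ∈ l, p x) →
    ∃ A y B, l = A ++ y :: B ∧ p y ∧ ∀ z ∈ A, ¬ p z
  | [], h => by simp at h
  | x :: l, h => by
    by_cases hx : p x
    · exact ⟨[], x, l, rfl, hx, by simp⟩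
    · obtain ⟨A, y, B, rfl, h1, h2⟩ := exists_eq_append_of_first p l (by simpa [hx] using h)
      exact ⟨x :: A, y, B, rfl, h1, by simpa [hx] using h2⟩

/-- A nonseparable set that shares two vertices with a clique `D` of order `c` lies in `D`:
otherwise, deleting the end `a` of an edge that leaves `D` does not disconnect it, and a path back
to `D` that avoids `a` gives an ear of `D`. -/
theorem CircumferenceLE.subset_of_isNonseparable [Fintype V] (h : CircumferenceLE G univ c)
    {D X : Finset V} (hD : G.IsNClique c D) (hX : IsNonseparable G X) {a b : V} (hab : a ≠ b)
    (ha : a ∈ D) (hb : b ∈ D) (haX : a ∈ X) (hbX : b ∈ X) : X ⊆ D := by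
  classical
  by_contra hXD
  obtain ⟨z, hzX, hzD⟩ := not_subset.1 hXD
  -- an edge of `X` that leaves `D`
  obtain ⟨l, hl1, hl2, hlX, hlz, hla⟩ := exists_isPathIn_of_connected hX.2.1 hzX haX
  obtain ⟨A, a', B, rfl, ha', hA⟩ := exists_eq_append_of_first (· ∈ D) l ⟨a, hla, ha⟩
  obtain rfl | ⟨A, y, rfl⟩ := List.eq_nil_or_concat A
  · simp at hlz; exact hzD (hlz ▸ ha')
  have ha'X : a' ∈ X := hlX a' (by simp)
  have hyX : y ∈ X := hlX y (by simp)
  have hyD : y ∉ D := hA y (by simp)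
  have hya' : G.Adj y a' := by
    have := (List.isChain_append.1 hl2).2.2
    simpa using this
  obtain ⟨b', hb', hb'X, hb'a⟩ : ∃ b' ∈ D, b' ∈ X ∧ b' ≠ a' := by
    by_cases haa : a = a'
    · exact ⟨b, hb, hbX, fun h => hab (haa.trans h.symm)⟩
    · exact ⟨a, ha, haX, haa⟩
  obtain ⟨l, hl1, hl2, hlX, hly, hlb⟩ := exists_isPathIn_of_connected (hX.2.2 a' ha'X)
    (a := y) (b := b') ⟨hyX, hya'.ne⟩ ⟨hb'X, hb'a⟩
  obtain ⟨A, d, B, rfl, hd, hA⟩ := exists_eq_append_of_first (· ∈ D) l ⟨b', hlb, hb'⟩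
  have hA0 : A ≠ [] := by
    rintro rfl
    simp at hly
    exact hyD (hly ▸ hd)
  have hdne : a' ≠ d := fun h => (hlX d (by simp)).2 h.symm
  rw [List.isChain_append] at hl2
  refine h.no_ear hD (subset_univ _) ha' hd hdne hA0 ⟨(List.nodup_append.1 hl1).1, hl2.1, by simp⟩
    hA ?_ (fun x hx => hl2.2.2 x hx d (by simp))
  obtain ⟨y', A, rfl⟩ := List.exists_cons_of_ne_nil hA0
  simp at hly
  simpa [hly] using hya'.symm

theorem CliqueTree.connected [Fintype V] [Nonempty V] (h : CliqueTree G univ c) :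
    G.Connected := by
  refine ⟨fun a b => ?_⟩
  obtain ⟨l, hl, hla, hlb⟩ := h.1 a (mem_univ _) b (mem_univ _)
  have hne : l ≠ [] := by rintro rfl; simp at hla
  have p := SimpleGraph.Walk.ofSupport l hne hl.2.1
  rw [List.head?_eq_some_head hne, Option.some.injEq] at hla
  rw [List.getLast?_eq_some_getLast hne, Option.some.injEq] at hlb
  rw [hla, hlb] at p
  exact ⟨p⟩

theorem CliqueTree.isNClique_of_isBlock [Fintype V] (h : CliqueTree G univ c)
    (hcirc : CircumferenceLE G univ c) (hc : 2 ≤ c) {X : Finset V} (hX : IsBlock G X) :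
    G.IsNClique c X := by
  obtain ⟨h2, hconn, -⟩ := hX.prop
  obtain ⟨a, ha, b, hb, hab⟩ := one_lt_card.1 h2
  have : Nontrivial (X : Set V) := ⟨⟨⟨a, ha⟩, ⟨b, hb⟩, fun h => hab (congrArg Subtype.val h)⟩⟩
  obtain ⟨y, hy⟩ := hconn.preconnected.exists_adj_of_nontrivial ⟨a, ha⟩
  obtain ⟨D, -, hD, haD, hyD⟩ := h.2 a (mem_univ _) y (mem_univ _) hy
  have hXD := hcirc.subset_of_isNonseparable hD hX.prop (SimpleGraph.Adj.ne hy) haD hyD ha y.2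
  rwa [hX.eq_of_le (isNonseparable_of_isNClique hD hc) hXD]

theorem exists_isBlock_of_adj [Finite V] {x y : V} (h : G.Adj x y) :
    ∃ D, IsBlock G D ∧ x ∈ D ∧ y ∈ D := by
  classical
  have hpair : IsNonseparable G {x, y} := by
    refine isNonseparable_of_isNClique (c := 2) ⟨?_, card_pair h.ne⟩ le_rfl
    rw [coe_pair, SimpleGraph.isClique_pair]
    exact fun _ => h
  obtain ⟨D, hD, hmax⟩ := (Set.toFinite {D | IsNonseparable G D}).exists_le_maximal hpair
  exact ⟨D, hmax, hD (by simp), hD (by simp)⟩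

/-- If every edge of a connected graph lies in a member of `𝒟`, then stars that span the members of
`𝒟` form a connected graph together, which has at least `|V| - 1` edges. -/
theorem card_le_of_connected [DecidableEq V] [Fintype V] (hG : G.Connected) (hc : 1 ≤ c)
    {𝒟 : Finset (Finset V)} (hsize : ∀ D ∈ 𝒟, #D = c)
    (hcov : ∀ x y, G.Adj x y → ∃ D ∈ 𝒟, x ∈ D ∧ y ∈ D) :
    Fintype.card V ≤ #𝒟 * (c - 1) + 1 := by
  have hne : ∀ D ∈ 𝒟, D.Nonempty := fun D hD => card_pos.1 (by rw [hsize D hD]; omega)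
  have hcentre : ∀ D : Finset V, ∃ v, D ∈ 𝒟 → v ∈ D := fun D => by
    by_cases hD : D ∈ 𝒟
    · exact (hne D hD).imp fun v hv _ => hv
    · exact ⟨hG.nonempty.some, fun h => (hD h).elim⟩
  choose f hf using hcentre
  let E : Finset (Sym2 V) := 𝒟.biUnion fun D => (D.erase (f D)).image fun v => s(f D, v)
  have hE : #E ≤ #𝒟 * (c - 1) := by
    refine card_biUnion_le_card_mul _ _ _ fun D hD => card_image_le.trans ?_
    rw [card_erase_of_mem (hf D hD), hsize D hD]
  have hstar : ∀ D ∈ 𝒟, ∀ v ∈ D,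
      (SimpleGraph.fromEdgeSet (E : Set (Sym2 V))).Reachable (f D) v := by
    intro D hD v hv
    by_cases hvf : v = f D
    · rw [hvf]
    · refine SimpleGraph.Adj.reachable ((SimpleGraph.fromEdgeSet_adj _).2 ⟨?_, Ne.symm hvf⟩)
      exact mem_biUnion.2 ⟨D, hD, mem_image.2 ⟨v, mem_erase.2 ⟨hvf, hv⟩, rfl⟩⟩
  have hconn : (SimpleGraph.fromEdgeSet (E : Set (Sym2 V))).Connected := by
    have := hG.nonempty
    refine ⟨fun a b => ?_⟩
    obtain ⟨p⟩ := hG.preconnected a b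
    induction p with
    | nil => rfl
    | cons hadj _ ih =>
      obtain ⟨D, hD, hx, hy⟩ := hcov _ _ hadj
      exact ((hstar D hD _ hx).symm.trans (hstar D hD _ hy)).trans ih
  have h1 := hconn.card_vert_le_card_edgeSet_add_one
  have h2 : Nat.card (SimpleGraph.fromEdgeSet (E : Set (Sym2 V))).edgeSet ≤ #E := by
    rw [← Set.ncard_coe_finset E, ← Nat.card_coe_set_eq (E : Set (Sym2 V))]
    refine Nat.card_mono E.finite_toSet ?_
    rw [SimpleGraph.edgeSet_fromEdgeSet]
    exact Set.sdiff_subset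
  rw [Nat.card_eq_fintype_card] at h1
  omega

/-- A connected hypergraph with complete blocks has at least the extremal number of edges. Two
blocks share at most one vertex, so no edge is counted twice. -/
theorem le_mul_card_of_blocks [DecidableEq V] [Fintype V] {H : Finset (Finset V)} (hr : 2 ≤ r)
    (hc : 1 ≤ c) (hG : (twoShadow H).Connected)
    (hblock : ∀ D, IsBlock (twoShadow H) D →
      (twoShadow H).IsNClique c D ∧ inducedEdges H D = D.powersetCard r) :
    Fintype.card V * c.choose r ≤ (c - 1) * #H + c.choose r := by
  classical
  let 𝒟 : Finset (Finset V) := univ.filter (IsBlock (twoShadow H))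
  have hmem : ∀ D, D ∈ 𝒟 ↔ IsBlock (twoShadow H) D := fun D => by simp [𝒟]
  have hsize : ∀ D ∈ 𝒟, #D = c := fun D hD => (hblock D ((hmem D).1 hD)).1.2
  have h1 := card_le_of_connected hG hc hsize fun x y hxy => by
    obtain ⟨D, hD, h⟩ := exists_isBlock_of_adj hxy
    exact ⟨D, (hmem D).2 hD, h⟩
  have h2 := card_biUnion_powersetCard hr hsize fun D hD D' hD' a b hab ha hb ha' hb' => by
    have hB := (hmem D).1 hD
    have hB' := (hmem D').1 hD'
    have hU := hB.prop.union hB'.prop hab ha hb ha' hb'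
    exact (hB.eq_of_le hU subset_union_left).trans (hB'.eq_of_le hU subset_union_right).symm
  have h3 : 𝒟.biUnion (powersetCard r) ⊆ H := by
    refine biUnion_subset.2 fun D hD => ?_
    rw [← (hblock D ((hmem D).1 hD)).2]
    exact filter_subset _ _
  have h4 := card_le_card h3
  rw [h2] at h4
  calc Fintype.card V * c.choose r ≤ (#𝒟 * (c - 1) + 1) * c.choose r := by gcongr
    _ = (c - 1) * (#𝒟 * c.choose r) + c.choose r := by ring
    _ ≤ _ := by gcongr

end

end BergeCycles

theorem theorem3 {V : Type*} [Fintype V] [DecidableEq V] [Nonempty V] (r k : ℕ)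
    (hr : 3 ≤ r) (hk : r + 3 ≤ k) (H : Finset (Finset V))
    (hH : (H : Set (Finset V)).Sized r)
    (hcycle : ∀ ℓ : ℕ, k ≤ ℓ → ¬ BergeCycles.HasBergeCycle H ℓ) :
    (H.card : ℝ) ≤ ((Fintype.card V : ℝ) - 1) / ((k : ℝ) - 2) * ((k - 1).choose r : ℝ) ∧
    ((H.card : ℝ) = ((Fintype.card V : ℝ) - 1) / ((k : ℝ) - 2) * ((k - 1).choose r : ℝ) ↔
      (BergeCycles.twoShadow H).Connected ∧
        ∀ D : Finset V, BergeCycles.IsBlock (BergeCycles.twoShadow H) D →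
          (BergeCycles.twoShadow H).IsNClique (k - 1) D ∧
            BergeCycles.inducedEdges H D = D.powersetCard r) := by
  obtain ⟨c, rfl⟩ : ∃ c, k = c + 1 := ⟨k - 1, by omega⟩
  simp only [Nat.add_sub_cancel]
  have hcycle' : ∀ ℓ, c < ℓ → ¬ BergeCycles.HasBergeCycle H ℓ := hcycle
  have hle := BergeCycles.mul_card_add_choose_le hr (by omega) hH hcycle'
  have hcast : ((c - 1 : ℕ) : ℝ) = (c : ℝ) - 1 := by
    rw [Nat.cast_sub (by omega), Nat.cast_one]
  have hpos : (0 : ℝ) < ((c + 1 : ℕ) : ℝ) - 2 := by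
    have : (6 : ℝ) ≤ ((c + 1 : ℕ) : ℝ) := by exact_mod_cast (by omega : 6 ≤ c + 1)
    linarith
  have hden : ((c + 1 : ℕ) : ℝ) - 2 = ((c - 1 : ℕ) : ℝ) := by
    rw [hcast]; push_cast; ring
  refine ⟨?_, fun heq => ?_, fun ⟨hconn, hblock⟩ => ?_⟩
  · rw [div_mul_eq_mul_div, le_div_iff₀ hpos, hden]
    have : ((c - 1 : ℕ) : ℝ) * (H.card : ℝ) + (c.choose r : ℝ) ≤
        (Fintype.card V : ℝ) * (c.choose r : ℝ) := by exact_mod_cast hle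
    linarith
  · rw [div_mul_eq_mul_div, eq_div_iff hpos.ne', hden] at heq
    have heq' : (c - 1) * H.card + c.choose r = Fintype.card V * c.choose r := by
      have : ((c - 1 : ℕ) : ℝ) * (H.card : ℝ) + (c.choose r : ℝ) =
        (Fintype.card V : ℝ) * (c.choose r : ℝ) := by linarith
      exact_mod_cast this
    obtain ⟨hcirc, htree, hfull⟩ :=
      BergeCycles.extremal_structure hr (by omega) hH hcycle' heq'
    refine ⟨htree.connected, fun D hD => ?_⟩
    have hDc := htree.isNClique_of_isBlock hcirc (by omega) hD
    refine ⟨hDc, ?_⟩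
    ext e
    simp only [BergeCycles.inducedEdges, Finset.mem_filter, Finset.mem_powersetCard]
    exact ⟨fun h => ⟨h.2, hH h.1⟩, fun h => ⟨hfull D hDc (Finset.mem_powersetCard.2 h), h.1⟩⟩
  · have hge := BergeCycles.le_mul_card_of_blocks (by omega) (by omega) hconn hblock
    rw [div_mul_eq_mul_div, eq_div_iff hpos.ne', hden]
    have : ((c - 1 : ℕ) : ℝ) * (H.card : ℝ) + (c.choose r : ℝ) =
        (Fintype.card V : ℝ) * (c.choose r : ℝ) := by exact_mod_cast le_antisymm hle hge
    linarith
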